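/- Let $p$ be a prime, $n\ge 1$, $m=p^n$, and let $\mathcal T$ be the $m$-adic rooted tree, whose vertices are the words in the alphabet $X=\{x_1,\dots,x_m\}$. For $f\in\operatorname{Aut}\mathcal T$ and a vertex $u$, the section $f_u\in\operatorname{Aut}\mathcal T$ is defined by $f(uz)=f(u)f_u(z)$ for all words $z$; let $\operatorname{st}(1)$ be the pointwise stabilizer of the first level in $\operatorname{Aut}\mathcal T$, and $\psi(f)=(f_{x_1},\dots,f_{x_m})$ for $f\in\operatorname{st}(1)$. Let $\mathbf e=(e_1,\dots,e_{m-1})\in(\mathbb Z/m\mathbb Z)^{m-1}$ be a vector with at least one entry $e_i\not\equiv 0 \pmod p$, and let $G=\langle a,b\rangle\le\operatorname{Aut}\mathcal T$ be the GGS-group with defining vector $\mathbf e$: here $a(x_iz)=x_{i+1}z$ for $i<m$ and $a(x_mz)=x_1z$, for all words $z$, and $b\in\operatorname{st}(1)$ is given recursively by $\psi(b)=(a^{e_1},\dots,a^{e_{m-1}},b)$. If $G$ is periodic (every element of $G$ has finite order), then $G$ is regular branch over $K=\gamma_3(G)=[[G,G],G]$. That is: $G$ is transitive on every level of $\mathcal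 T$; $g_u\in G$ for all $g\in G$ and all vertices $u$; $1\ne K\le \operatorname{st}(1)\cap G$; $K\times\overset{m}{\cdots}\times K\subseteq\psi(K)$; and $|G:K|$ is finite. -/

import Mathlib

namespace GGS

/-- The `m`-adic tree: vertices are the words in an alphabet with `m` letters `x_1 < ⋯ < x_m`
(the letter `x_i` being `i - 1 : Fin m`), and two vertices are joined by an edge when one of them is
obtained from the other by appending one letter. -/
def adicTree (m : ℕ) : SimpleGraph (List (Fin m)) where
  Adj u v := (∃ x, v = u ++ [x]) ∨ (∃ x, u = v ++ [x])
  symm := ⟨fun _ _ h => h.symm⟩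
  loopless := ⟨fun u h => by simp at h⟩

/-- The group `Aut T` of graph automorphisms of the `m`-adic tree, under composition. -/
abbrev TreeAut (m : ℕ) : Type := adicTree m ≃g adicTree m

/-- `IsSection f u h` says that `h = f_u` is the section of `f` at the vertex `u`:
`f (u z) = f (u) h (z)` for all words `z`. -/
def IsSection {m : ℕ} (f : TreeAut m) (u : List (Fin m)) (h : TreeAut m) : Prop :=
  ∀ z, f (u ++ z) = f u ++ h z

/-- The pointwise stabilizer `st(ℓ)` of the `ℓ`-th level in `Aut T`. -/
def levelStabilizer (m ℓ : ℕ) : Subgroup (TreeAut m) where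
  carrier := {f | ∀ u : List (Fin m), u.length = ℓ → f u = u}
  one_mem' := fun _ _ => rfl
  mul_mem' := by
    intro f g hf hg u hu
    rw [RelIso.mul_apply, hg u hu, hf u hu]
  inv_mem' := by
    intro f hf u hu
    have h := hf u hu
    calc f⁻¹ u = f⁻¹ (f u) := by rw [h]
      _ = u := RelIso.inv_apply_self f u

/-- `G` acts transitively on every level of the tree. -/
def SphericallyTransitive {m : ℕ} (G : Subgroup (TreeAut m)) : Prop :=
  ∀ ℓ : ℕ, ∀ u v : List (Fin m), u.length = ℓ → v.length = ℓ → ∃ g ∈ G, g u = v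

/-- All sections of elements of `G` belong to `G`. -/
def SelfSimilar {m : ℕ} (G : Subgroup (TreeAut m)) : Prop :=
  ∀ g ∈ G, ∀ u : List (Fin m), ∃ h ∈ G, IsSection g u h

/-- `PsiEq g k` says that `g ∈ st(1)` and `ψ(g) = (k_{x_1}, …, k_{x_m})`. -/
def PsiEq {m : ℕ} (g : TreeAut m) (k : Fin m → TreeAut m) : Prop :=
  g ∈ levelStabilizer m 1 ∧ ∀ x : Fin m, IsSection g [x] (k x)

/-- `G` is weakly regular branch over `K`: `G` is spherically transitive and self-similar,
`1 ≠ K ≤ st_G(1)`, and `K × ⋯ × K ⊆ ψ(K)`. -/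
structure WeaklyRegularBranchOver {m : ℕ} (G K : Subgroup (TreeAut m)) : Prop where
  sphericallyTransitive : SphericallyTransitive G
  selfSimilar : SelfSimilar G
  ne_bot : K ≠ ⊥
  le_stabilizer : K ≤ levelStabilizer m 1 ⊓ G
  prod_subset : ∀ k : Fin m → TreeAut m, (∀ x, k x ∈ K) → ∃ g ∈ K, PsiEq g k

/-- `G` is regular branch over `K`: it is weakly regular branch over `K` and `|G : K|` is finite. -/
structure RegularBranchOver {m : ℕ} (G K : Subgroup (TreeAut m)) : Prop
    extends WeaklyRegularBranchOver G K where
  finite_index : K.IsFiniteRelIndex G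

/-- Auxiliary: a permutation of the words that fixes the root and maps immediate descendants to
immediate descendants, as does its inverse, is a tree automorphism. -/
def TreeAut.ofEquiv {m : ℕ} (f : List (Fin m) ≃ List (Fin m))
    (hf : ∀ u x, ∃ y, f (u ++ [x]) = f u ++ [y])
    (hf' : ∀ u x, ∃ y, f.symm (u ++ [x]) = f.symm u ++ [y]) : TreeAut m where
  toEquiv := f
  map_rel_iff' := by
    have key : ∀ h : List (Fin m) → List (Fin m), (∀ u x, ∃ y, h (u ++ [x]) = h u ++ [y]) →
        ∀ u v, (adicTree m).Adj u v → (adicTree m).Adj (h u) (h v) := by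
      rintro h hh u v (⟨x, rfl⟩ | ⟨x, rfl⟩)
      · exact Or.inl (hh u x)
      · exact Or.inr (hh v x)
    intro u v
    refine ⟨fun h => ?_, key f hf u v⟩
    simpa using key f.symm hf' _ _ h

/-- The map `x z ↦ ρ(x) z` on words. -/
def rootedFun {m : ℕ} (ρ : Equiv.Perm (Fin m)) : List (Fin m) → List (Fin m)
  | [] => []
  | x :: z => ρ x :: z

theorem rootedFun_append {m : ℕ} (ρ : Equiv.Perm (Fin m)) (u : List (Fin m)) (x : Fin m) :
    ∃ y, rootedFun ρ (u ++ [x]) = rootedFun ρ u ++ [y] := by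
  cases u with
  | nil => exact ⟨ρ x, rfl⟩
  | cons c u => exact ⟨x, rfl⟩

/-- The rooted automorphism corresponding to the permutation `ρ`. -/
def rooted {m : ℕ} (ρ : Equiv.Perm (Fin m)) : TreeAut m :=
  TreeAut.ofEquiv
    { toFun := rootedFun ρ
      invFun := rootedFun ρ⁻¹
      left_inv := by rintro (_ | ⟨x, z⟩) <;> simp [rootedFun]
      right_inv := by rintro (_ | ⟨x, z⟩) <;> simp [rootedFun] }
    (rootedFun_append ρ) (rootedFun_append ρ⁻¹)

/-- The generator `a`: the rooted automorphism corresponding to the cycle `(x_1, x_2, …, x_m)`. -/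
def genA (m : ℕ) : TreeAut m := rooted (finRotate m)

theorem rooted_pow {m : ℕ} (ρ : Equiv.Perm (Fin m)) (k : ℕ) : rooted ρ ^ k = rooted (ρ ^ k) := by
  induction k with
  | zero =>
    ext1 u
    rcases u with _ | ⟨x, z⟩ <;> rfl
  | succ k ih =>
    rw [pow_succ, pow_succ, ih]
    ext1 u
    rcases u with _ | ⟨x, z⟩ <;> rfl

theorem rooted_inv {m : ℕ} (ρ : Equiv.Perm (Fin m)) : (rooted ρ)⁻¹ = rooted ρ⁻¹ := by
  ext1 u
  rfl

/-- The map on words that fixes the letters `x_1, …, x_m` and acts as `c_i` below the letter `x_i`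
for `i < m` and as itself below the letter `x_m` (the automorphism `c_i` is `c (i - 1)`). -/
def directedFun {m : ℕ} (c : Fin (m - 1) → TreeAut m) : List (Fin m) → List (Fin m)
  | [] => []
  | x :: z => if h : (x : ℕ) < m - 1 then x :: c ⟨x, h⟩ z else x :: directedFun c z

theorem directedFun_append {m : ℕ} (ρ : Fin (m - 1) → Equiv.Perm (Fin m)) (u : List (Fin m))
    (x : Fin m) : ∃ y, directedFun (fun i => rooted (ρ i)) (u ++ [x])
      = directedFun (fun i => rooted (ρ i)) u ++ [y] := by
  induction u with
  | nil =>
    refine ⟨x, ?_⟩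
    by_cases h : (x : ℕ) < m - 1
    · simp only [List.nil_append, directedFun, dif_pos h]; rfl
    · simp [directedFun, h]
  | cons d u ih =>
    by_cases h : (d : ℕ) < m - 1
    · obtain ⟨y, hy⟩ := rootedFun_append (ρ ⟨d, h⟩) u x
      refine ⟨y, ?_⟩
      simp only [List.cons_append, directedFun, dif_pos h]
      exact congrArg (List.cons d) hy
    · obtain ⟨y, hy⟩ := ih
      exact ⟨y, by simp [directedFun, h, hy]⟩

theorem directedFun_inv {m : ℕ} (c : Fin (m - 1) → TreeAut m) (u : List (Fin m)) :
    directedFun (fun i => (c i)⁻¹) (directedFun c u) = u := by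
  induction u with
  | nil => rfl
  | cons d u ih => by_cases h : (d : ℕ) < m - 1 <;> simp [directedFun, h, ih]

/-- The generator `b ∈ st(1)` with `ψ(b) = (a^{e_1}, …, a^{e_{m-1}}, b)`; the entry `e_i` of the
defining vector is `e (i - 1)`. -/
def genB {m : ℕ} (e : Fin (m - 1) → ZMod m) : TreeAut m :=
  TreeAut.ofEquiv
    { toFun := directedFun (fun i => genA m ^ (e i).val)
      invFun := directedFun (fun i => (genA m ^ (e i).val)⁻¹)
      left_inv := directedFun_inv _
      right_inv := fun u => by
        simpa using directedFun_inv (fun i => (genA m ^ (e i).val)⁻¹) u }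
    (by
      simp only [genA, rooted_pow]
      exact directedFun_append _)
    (by
      simp only [genA, rooted_pow, rooted_inv]
      exact directedFun_append _)

/-- The defining recursion `ψ(b) = (a^{e_1}, …, a^{e_{m-1}}, b)`. -/
theorem genB_psi {m : ℕ} (e : Fin (m - 1) → ZMod m) :
    PsiEq (genB e) (fun x => if h : (x : ℕ) < m - 1 then genA m ^ (e ⟨x, h⟩).val else genB e) := by
  have h1 : ∀ x : Fin m, genB e [x] = [x] := by
    intro x
    change directedFun _ _ = _
    by_cases h : (x : ℕ) < m - 1
    · simp only [directedFun, dif_pos h, genA, rooted_pow]; rfl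
    · simp [directedFun, h]
  refine ⟨fun u hu => ?_, fun x z => ?_⟩
  · obtain ⟨x, rfl⟩ := List.length_eq_one_iff.1 hu
    exact h1 x
  · rw [h1]
    change directedFun _ (x :: z) = _
    by_cases h : (x : ℕ) < m - 1
    · simp [directedFun, h]
    · simp only [directedFun, dif_neg h]; rfl

/-- The GGS-group `⟨a, b⟩` with defining vector `e`. -/
def ggsGroup {m : ℕ} (e : Fin (m - 1) → ZMod m) : Subgroup (TreeAut m) :=
  Subgroup.closure {genA m, genB e}

/-- The set `F(p^n)` of the defining vectors that are not trivial modulo `p`. -/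
def nontrivialModP (p n : ℕ) : Set (Fin (p ^ n - 1) → ZMod (p ^ n)) :=
  {e | ∃ i, ¬ (p : ZMod (p ^ n)) ∣ e i}

end GGS

/-! Identify the first level with a cyclic group `I` of order `m` and let `T` be `γ₃(G)^I`. Let `Q ≤
T` consist of the tuples that are the sections of an element of `γ₃(G)`; the claim is essentially `Q
= T`. Periodicity is used twice: it makes `G` a `p`-group (`isPGroup_of_torsion`), and it forces the
exponents of `b` to sum to 0 mod `p` (`sum_eq_zero_of_torsion`). Hence at least two exponents are
units mod `p`.

Two units at different positions give `[T, T] ≤ Q` (`commutator_le_branchSubgroup`). Conjugation by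
`G` acts on `T` and preserves `Q`, so if `Q ≠ T`, the fixed point theorem for `p`-groups yields a
nontrivial `G`-invariant character `χ : T → ℤ/p` killing `Q` (`eq_top_of_forall_invariant_hom`). By
invariance `χ` is the same conjugation invariant `φ` on every coordinate, and `φ` is determined by
the homomorphism `L(g) = φ[[b, a], g]`, that is, by `L(a)` and `L(b)`.

Let `b_i` be the conjugate of `b` with section `b` at `i`. The sections of `[[b_0, b_d], b_k]` are
trivial except possibly at `0` and `d`, so `χ` gives one linear relation on `L(a)`, `L(b)` for each
`k`. If `L(a) ≠ 0`, these relations make the exponents nearly invariant under translation by `d`,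
which contradicts their zero sum (`sum_ne_zero_of_proportional_translates`). So `L = 0`, hence `χ =
1` (`eq_one_of_invariant`), and `Q = T`. -/

namespace GGS

open scoped commutatorElement

/-! ### Commutator subgroups of two-generator groups -/

section CommutatorCriteria

variable {G : Type*} [Group G]

theorem commutatorElement_mem_iff_mk (M : Subgroup G) [M.Normal] (g h : G) :
    ⁅g, h⁆ ∈ M ↔ Commute (QuotientGroup.mk' M g) (QuotientGroup.mk' M h) := by
  rw [← commutatorElement_eq_one_iff_commute, ← map_commutatorElement]
  exact (QuotientGroup.eq_one_iff _).symm

theorem commutatorElement_mem_of_closure {s : Set G} (hs : Subgroup.closure s = ⊤)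
    (M : Subgroup G) [M.Normal] {g : G} (h : ∀ x ∈ s, ⁅g, x⁆ ∈ M) (x : G) : ⁅g, x⁆ ∈ M := by
  have hx : x ∈ Subgroup.closure s := hs ▸ Subgroup.mem_top x
  rw [commutatorElement_mem_iff_mk]
  induction hx using Subgroup.closure_induction with
  | mem x hx => exact (commutatorElement_mem_iff_mk M _ _).1 (h x hx)
  | one => simp
  | mul x y _ _ hx hy => rw [map_mul]; exact hx.mul_right hy
  | inv x _ hx => rw [map_inv]; exact hx.inv_right

theorem commutatorElement_mem_symm {M : Subgroup G} {g h : G} (H : ⁅g, h⁆ ∈ M) : ⁅h, g⁆ ∈ M := by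
  rw [← commutatorElement_inv]; exact M.inv_mem H

theorem commutator_le_of_closure_pair {x y : G} (hxy : Subgroup.closure {x, y} = ⊤)
    (M : Subgroup G) [M.Normal] (h : ⁅x, y⁆ ∈ M) : commutator G ≤ M := by
  have hx : ∀ z, ⁅x, z⁆ ∈ M := commutatorElement_mem_of_closure hxy M (by
    rintro z (rfl | rfl)
    · simp
    · exact h)
  have hy : ∀ z, ⁅y, z⁆ ∈ M := commutatorElement_mem_of_closure hxy M (by
    rintro z (rfl | rfl)
    · exact commutatorElement_mem_symm h
    · simp)
  rw [commutator_def, Subgroup.commutator_le]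
  intro g _ z _
  refine commutatorElement_mem_of_closure hxy M ?_ z
  rintro t (rfl | rfl)
  · exact commutatorElement_mem_symm (hx g)
  · exact commutatorElement_mem_symm (hy g)

/-- Modulo `M` the commutator of the generators is central. Applying the previous criterion to the
preimage of the centre of `G ⧸ M` makes all of `[G, G]` central modulo `M`. -/
theorem commutator_commutator_le_of_closure_pair {x y : G} (hxy : Subgroup.closure {x, y} = ⊤)
    (M : Subgroup G) [M.Normal] (hx : ⁅⁅x, y⁆, x⁆ ∈ M) (hy : ⁅⁅x, y⁆, y⁆ ∈ M) :
    ⁅commutator G, (⊤ : Subgroup G)⁆ ≤ M := by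
  have hc : ∀ z, ⁅⁅x, y⁆, z⁆ ∈ M := commutatorElement_mem_of_closure hxy M (by
    rintro z (rfl | rfl)
    · exact hx
    · exact hy)
  have h1 : commutator G ≤ (Subgroup.center (G ⧸ M)).comap (QuotientGroup.mk' M) := by
    refine commutator_le_of_closure_pair hxy _ ?_
    rw [Subgroup.mem_comap, Subgroup.mem_center_iff]
    intro q
    obtain ⟨z, rfl⟩ := QuotientGroup.mk'_surjective M q
    exact ((commutatorElement_mem_iff_mk M _ _).1 (hc z)).symm.eq
  rw [Subgroup.commutator_le]
  intro g hg z _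
  rw [commutatorElement_mem_iff_mk]
  exact ((Subgroup.mem_center_iff.1 (h1 hg)) _).symm

end CommutatorCriteria

/-! ### Invariant characters of `p`-groups -/

section InvariantCharacters

theorem exists_hom_zmod_of_index {T : Type*} [Group T] {p : ℕ} [Fact p.Prime] {N : Subgroup T}
    [N.Normal] (hN : N.index = p) :
    ∃ χ : T →* Multiplicative (ZMod p), χ ≠ 1 ∧ ∀ t ∈ N, χ t = 1 := by
  have hc : Nat.card (Multiplicative (ZMod p)) = p := by simp
  let E : (T ⧸ N) ≃* Multiplicative (ZMod p) := mulEquivOfPrimeCardEq hN hc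
  refine ⟨E.toMonoidHom.comp (QuotientGroup.mk' N), fun h => ?_, fun t ht => ?_⟩
  · have : N = ⊤ := by
      rw [eq_top_iff]
      intro t _
      have := DFunLike.congr_fun h t
      simpa using this
    rw [this, Subgroup.index_top] at hN
    exact (Fact.out : p.Prime).one_lt.ne hN
  · simpa using ht

theorem finiteIndex_of_commutator_le {T : Type*} [Group T] [Group.FG T]
    (hT : ∀ t : T, IsOfFinOrder t) {Q : Subgroup T} (hQ : commutator T ≤ Q) : Q.FiniteIndex := by
  have := Subgroup.Normal.of_commutator_le (G := T) hQ
  let : CommGroup (T ⧸ Q) :=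
    { (inferInstance : Group (T ⧸ Q)) with
      mul_comm := by
        intro x y
        obtain ⟨s, rfl⟩ := QuotientGroup.mk'_surjective Q x
        obtain ⟨t, rfl⟩ := QuotientGroup.mk'_surjective Q y
        exact (commutatorElement_mem_iff_mk Q s t).1
          (hQ (Subgroup.commutator_mem_commutator (Subgroup.mem_top s) (Subgroup.mem_top t))) }
  have : Finite (T ⧸ Q) := CommGroup.finite_of_fg_isMulTorsion _ (by
    intro q
    obtain ⟨t, rfl⟩ := QuotientGroup.mk'_surjective Q q
    exact MonoidHom.isOfFinOrder _ (hT t))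
  exact Subgroup.finiteIndex_of_finite_quotient

theorem exists_index_eq_prime {T : Type*} [Group T] {p : ℕ} [Fact p.Prime] (hT : IsPGroup p T)
    [Group.FG T] {Q : Subgroup T} (hQ : commutator T ≤ Q) (hne : Q ≠ ⊤) :
    Q.FiniteIndex ∧ ∃ N : Subgroup T, Q ≤ N ∧ N.index = p := by
  have hp : p.Prime := Fact.out
  have := Subgroup.Normal.of_commutator_le (G := T) hQ
  have hfi : Q.FiniteIndex :=
    finiteIndex_of_commutator_le (fun t => hT.isOfFinOrder hp.ne_zero t) hQ
  have : Finite (T ⧸ Q) := Subgroup.finite_quotient_of_finiteIndex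
  refine ⟨hfi, ?_⟩
  obtain ⟨k, hk⟩ := IsPGroup.iff_card.1 (hT.to_quotient Q)
  have hk0 : k ≠ 0 := by
    rintro rfl
    apply hne
    rw [← Subgroup.index_eq_one]
    exact hk
  obtain ⟨j, rfl⟩ := Nat.exists_eq_succ_of_ne_zero hk0
  obtain ⟨M, hM⟩ := Sylow.exists_subgroup_card_pow_prime p (G := T ⧸ Q) (n := j)
    (by rw [hk]; exact pow_dvd_pow _ (Nat.le_succ j))
  refine ⟨M.comap (QuotientGroup.mk' Q), ?_, ?_⟩
  · intro q hq
    have h1 : QuotientGroup.mk' Q q = 1 := (QuotientGroup.eq_one_iff q).2 hq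
    rw [Subgroup.mem_comap, h1]
    exact M.one_mem
  · rw [Subgroup.index_comap_of_surjective _ (QuotientGroup.mk'_surjective Q)]
    have := M.card_mul_index
    rw [hM, hk, pow_succ] at this
    exact Nat.eq_of_mul_eq_mul_left (pow_pos hp.pos j) this

/-- A `p`-group acting on a finitely generated `p`-group `T` fixes a nontrivial character of order
`p` of every nontrivial abelian quotient `T / Q` by an invariant subgroup. -/
theorem eq_top_of_forall_invariant_hom {p : ℕ} [Fact p.Prime] {H T : Type*} [Group H] [Group T]
    [MulDistribMulAction H T] (hH : IsPGroup p H) (hT : IsPGroup p T) [Group.FG T]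
    {Q : Subgroup T} (hQ : commutator T ≤ Q) (hHQ : ∀ h : H, ∀ q ∈ Q, h • q ∈ Q)
    (hχ : ∀ χ : T →* Multiplicative (ZMod p), (∀ q ∈ Q, χ q = 1) →
      (∀ (h : H) t, χ (h • t) = χ t) → χ = 1) : Q = ⊤ := by
  by_contra hne
  obtain ⟨hfi, N, hQN, hN⟩ := exists_index_eq_prime hT hQ hne
  have := Subgroup.Normal.of_commutator_le (G := T) hQ
  have := Subgroup.Normal.of_commutator_le (G := T) (hQ.trans hQN)
  -- The characters of order dividing `p` that kill `Q`: a finite `p`-group, nontrivial because of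
  -- the index `p` subgroup `N` above `Q`.
  let D : Subgroup (T →* Multiplicative (ZMod p)) :=
    { carrier := {χ | ∀ q ∈ Q, χ q = 1}
      one_mem' := fun _ _ => rfl
      mul_mem' := fun {χ ξ} h1 h2 q hq => by
        rw [MonoidHom.mul_apply, h1 q hq, h2 q hq, one_mul]
      inv_mem' := fun {χ} h1 q hq => by
        rw [MonoidHom.inv_apply, h1 q hq, inv_one] }
  obtain ⟨χ₀, hχ₀, hχ₀N⟩ := exists_hom_zmod_of_index hN
  have hD : IsPGroup p D := by
    rintro ⟨χ, hχ⟩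
    refine ⟨1, Subtype.ext (MonoidHom.ext fun t => ?_)⟩
    change (χ ^ p ^ 1) t = 1
    rw [pow_one, MonoidHom.pow_apply]
    apply Multiplicative.toAdd.injective
    simp
  have : Finite D := by
    have : Finite (T ⧸ Q) := Subgroup.finite_quotient_of_finiteIndex
    refine Finite.of_injective (β := (T ⧸ Q) → Multiplicative (ZMod p))
      (fun χ => QuotientGroup.lift Q χ.1 χ.2) ?_
    intro χ ξ h
    refine Subtype.ext (MonoidHom.ext fun t => ?_)
    exact congrFun h (QuotientGroup.mk t)
  let : MulAction H D :=
    { smul := fun h χ => ⟨χ.1.comp (MulDistribMulAction.toMonoidHom T h⁻¹),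
        fun q hq => χ.2 _ (hHQ h⁻¹ q hq)⟩
      one_smul := fun χ => Subtype.ext (MonoidHom.ext fun t => by
        change χ.1 ((1 : H)⁻¹ • t) = χ.1 t
        simp)
      mul_smul := fun g h χ => Subtype.ext (MonoidHom.ext fun t => by
        change χ.1 ((g * h)⁻¹ • t) = χ.1 (h⁻¹ • g⁻¹ • t)
        rw [mul_inv_rev, mul_smul]) }
  have hdvd : p ∣ Nat.card D := by
    rcases hD.card_eq_or_dvd with h | h
    · exfalso
      have := (Nat.card_eq_one_iff_unique.1 h).1
      have h2 := this.elim ⟨χ₀, fun q hq => hχ₀N q (hQN hq)⟩ (1 : D)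
      exact hχ₀ (congrArg Subtype.val h2)
    · exact h
  have h1 : (1 : D) ∈ MulAction.fixedPoints H D := fun h => Subtype.ext (MonoidHom.ext fun t => rfl)
  -- The number of fixed points is divisible by `p`, so the trivial character is not the only one.
  obtain ⟨χ, hfix, hne1⟩ := hH.exists_fixed_point_of_prime_dvd_card_of_fixed_point D hdvd h1
  apply hne1
  refine (Subtype.ext (hχ χ.1 χ.2 fun h t => ?_)).symm
  have := congrArg (fun ξ : D => ξ.1 t) (hfix h⁻¹)
  change χ.1 (h⁻¹⁻¹ • t) = χ.1 t at this
  rwa [inv_inv] at this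

end InvariantCharacters

/-! ### Functions on an abelian `p`-group and their sums mod `p` -/

section TranslationInvariance

variable {I : Type*} [AddCommGroup I] [Fintype I] {p : ℕ}

theorem eq_zero_of_coprime_nsmul (hI : ∃ n, Fintype.card I = p ^ n) {q : ℕ}
    (hq : p.Coprime q) {v : I} (hv : q • v = 0) : v = 0 := by
  obtain ⟨n, hn⟩ := hI
  have h3 : p ^ n • v = 0 := by rw [← hn]; exact card_nsmul_eq_zero
  have h4 : addOrderOf v ∣ 1 := by
    rw [← Nat.Coprime.pow_left n hq]
    exact Nat.dvd_gcd (addOrderOf_dvd_of_nsmul_eq_zero h3) (addOrderOf_dvd_of_nsmul_eq_zero hv)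
  exact AddMonoid.addOrderOf_eq_one_iff.1 (Nat.dvd_one.1 h4)

/-- The function is constant on the cosets of `⟨d⟩`, whose size is divisible by `p`. -/
theorem sum_eq_zero_of_translation_invariant (hI : ∃ n, Fintype.card I = p ^ n) [Fact p.Prime]
    (f : I → ZMod p) {d : I} (hd : d ≠ 0) (hf : ∀ x, f (x + d) = f x) : ∑ x, f x = 0 := by
  classical
  have hp : p.Prime := Fact.out
  let Z := AddSubgroup.zmultiples d
  have hZ : ∀ z ∈ Z, ∀ x, f (x + z) = f x := by
    rintro z ⟨k, rfl⟩
    change ∀ x, f (x + k • d) = f x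
    induction k with
    | zero => simp
    | succ k ih => intro x; rw [add_smul, one_smul, ← add_assoc, hf, ih]
    | pred k ih =>
      intro x
      rw [← hf, ← ih x]
      congr 1
      rw [sub_smul, one_smul]; abel
  have hdvd : p ∣ Nat.card Z := by
    obtain ⟨n, hn⟩ := hI
    have h1 : Nat.card Z ∣ p ^ n := by
      rw [← hn, ← Nat.card_eq_fintype_card]; exact AddSubgroup.card_addSubgroup_dvd_card Z
    obtain ⟨k, -, hk⟩ := (Nat.dvd_prime_pow hp).1 h1
    have hk0 : k ≠ 0 := by
      rintro rfl
      rw [pow_zero] at hk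
      have := AddSubgroup.card_eq_one.1 hk
      exact hd (AddSubgroup.zmultiples_eq_bot.1 this)
    rw [hk]; exact dvd_pow_self p hk0
  let F : (I ⧸ Z) × Z → I := fun q => q.1.out + q.2
  have hmk : ∀ q z, (QuotientAddGroup.mk (F (q, z)) : I ⧸ Z) = q := fun q z => by
    rw [QuotientAddGroup.mk_add_of_mem _ z.2]; exact q.out_eq
  have hF : F.Bijective := by
    refine ⟨fun ⟨q, z⟩ ⟨q', z'⟩ h => ?_, fun x => ⟨(QuotientAddGroup.mk x,
      ⟨-(QuotientAddGroup.mk x : I ⧸ Z).out + x, ?_⟩), ?_⟩⟩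
    · obtain rfl : q = q' := by rw [← hmk q z, h, hmk]
      exact Prod.ext rfl (Subtype.ext (add_left_cancel h))
    · rw [← QuotientAddGroup.eq]; exact Quotient.out_eq _
    · exact add_neg_cancel_left _ _
  have key : ∀ q z, f (F (q, z)) = f q.out := fun q z => hZ z z.2 _
  rw [← (Equiv.ofBijective F hF).sum_comp, Fintype.sum_prod_type]
  refine Finset.sum_eq_zero fun q _ => ?_
  simp only [Equiv.ofBijective_apply]
  rw [Finset.sum_congr rfl fun z _ => key q z, Finset.sum_const, Finset.card_univ,
    ← Nat.card_eq_fintype_card, nsmul_eq_mul, (ZMod.natCast_eq_zero_iff _ _).2 hdvd, zero_mul]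

/-- The hypotheses are what an invariant character imposes on the exponents of `b`. If the sum
vanished, `f d = f (-d)` would follow, and changing `f` at `0` alone would make it invariant under
translation by `d`. -/
theorem sum_ne_zero_of_proportional_translates (hI : ∃ n, Fintype.card I = p ^ n) [Fact p.Prime]
    (f : I → ZMod p) (h0 : f 0 = 0) {d : I} (hd : d ≠ 0) (hfd : f (-d) ≠ 0)
    (hcube : f d ^ 3 = f (-d) ^ 3)
    (hprop : ∀ k, k ≠ 0 → k ≠ d → f (-d) * f (-k) = f d * f (d - k)) : ∑ x, f x ≠ 0 := by
  classical
  intro hsum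
  have h1 : ∑ k, f (-k) = 0 := by rw [← hsum]; exact Equiv.sum_comp (Equiv.neg I) f
  have h2 : ∑ k, f (d - k) = 0 := by rw [← hsum]; exact Equiv.sum_comp (Equiv.subLeft d) f
  have hsq : f (-d) ^ 2 = f d ^ 2 := by
    -- Only `k = 0` and `k = d` escape `hprop`; they contribute `-f d ^ 2` and `f (-d) ^ 2`.
    have h3 : ∑ k, (f (-d) * f (-k) - f d * f (d - k)) = 0 := by
      rw [Finset.sum_sub_distrib, ← Finset.mul_sum, ← Finset.mul_sum, h1, h2]; simp
    rw [Fintype.sum_eq_add 0 d hd.symm] at h3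
    · simp only [neg_zero, h0, sub_zero, sub_self, mul_zero] at h3
      linear_combination h3
    · rintro k ⟨hk0, hkd⟩
      rw [hprop k hk0 hkd, sub_self]
  have heq : f d = f (-d) := by
    have : f (-d) ^ 2 * (f d - f (-d)) = 0 := by
      linear_combination hcube + f d * hsq
    rcases mul_eq_zero.1 this with h | h
    · exact absurd (pow_eq_zero_iff two_ne_zero |>.1 h) hfd
    · exact sub_eq_zero.1 h
  -- `F` replaces the value `f 0 = 0` by `f d`, so its sum is `f d ≠ 0` although it is
  -- `d`-invariant.
  let F : I → ZMod p := fun x => f x + if x = 0 then f d else 0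
  have hF : ∀ x, F (x + d) = F x := by
    intro x
    by_cases hx0 : x = 0
    · subst hx0
      simp [F, hd, h0]
    by_cases hxd : x = -d
    · subst hxd
      simp [F, hd, h0, heq]
    · have h := hprop (-x) (neg_ne_zero.2 hx0) (fun h => hxd (by rw [← h, neg_neg]))
      rw [heq, neg_neg, sub_neg_eq_add] at h
      have hxd' : x + d ≠ 0 := fun h => hxd (eq_neg_of_add_eq_zero_left h)
      simp only [F, hx0, hxd', if_false, add_zero]
      rw [add_comm x d]
      exact (mul_left_cancel₀ hfd h).symm
  have := sum_eq_zero_of_translation_invariant hI F hd hF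
  rw [Finset.sum_add_distrib, hsum, zero_add, Finset.sum_ite_eq' Finset.univ (0 : I)] at this
  simp only [Finset.mem_univ, if_true] at this
  exact hfd (heq ▸ this)

end TranslationInvariance

/-! ### The pairing attached to an invariant homomorphism on `γ₃(G)` -/

/-- The third term `γ₃(G) = [[G, G], G]` of the lower central series. -/
abbrev gammaThree (G : Type*) [Group G] : Subgroup G := ⁅commutator G, (⊤ : Subgroup G)⁆

section Pairing

variable {G A : Type*} [Group G] [CommGroup A]

theorem commutatorElement_mem_gammaThree (x : commutator G) (g : G) :
    ⁅(x : G), g⁆ ∈ gammaThree G :=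
  Subgroup.commutator_mem_commutator x.2 (Subgroup.mem_top g)

/-- The bimultiplicative map `(x, g) ↦ φ [x, g]` attached to a conjugation invariant homomorphism
`φ` on `γ₃(G)`. -/
def commutatorPairing (φ : gammaThree G →* A)
    (hφ : ∀ (h : G) (x : gammaThree G), φ (MulAut.conjNormal h x) = φ x) :
    commutator G →* (G →* A) :=
  MonoidHom.mk' (fun x => MonoidHom.mk' (fun g => φ ⟨⁅(x : G), g⁆,
      commutatorElement_mem_gammaThree x g⟩) (fun g h => by
      -- `[x, gh] = [x, g] · g[x, h]g⁻¹`, and `φ` does not see the conjugation.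
      rw [← hφ g ⟨⁅(x : G), h⁆, _⟩, ← map_mul]
      congr 1
      apply Subtype.ext
      simp [commutatorElement_def, mul_assoc]))
    (fun x y => MonoidHom.ext fun g => by
      change φ _ = φ _ * φ _
      -- `[xy, g] = x[y, g]x⁻¹ · [x, g]`.
      rw [mul_comm, ← hφ x ⟨⁅(y : G), g⁆, _⟩, ← map_mul]
      congr 1
      apply Subtype.ext
      simp [commutatorElement_def, mul_assoc])

variable (φ : gammaThree G →* A)
  (hφ : ∀ (h : G) (x : gammaThree G), φ (MulAut.conjNormal h x) = φ x)

theorem commutatorPairing_apply (x : commutator G) (g : G) :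
    commutatorPairing φ hφ x g = φ ⟨⁅(x : G), g⁆, commutatorElement_mem_gammaThree x g⟩ := rfl

/-- Conjugating both arguments changes nothing since `φ` is invariant; conjugating the second alone
changes nothing since `A` is abelian. -/
theorem commutatorPairing_conj (h : G) (x : commutator G) :
    commutatorPairing φ hφ (MulAut.conjNormal h x) = commutatorPairing φ hφ x := by
  ext g
  have h1 : commutatorPairing φ hφ (MulAut.conjNormal h x) (h * g * h⁻¹)
      = commutatorPairing φ hφ x g := by
    rw [commutatorPairing_apply, commutatorPairing_apply, ← hφ h ⟨⁅(x : G), g⁆, _⟩]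
    congr 1
    apply Subtype.ext
    simp [commutatorElement_def, mul_assoc]
  rw [← h1, map_mul, map_mul, map_inv, mul_comm, inv_mul_cancel_left]

theorem commutatorElement_mem_commutator (g h : G) : ⁅g, h⁆ ∈ commutator G :=
  Subgroup.commutator_mem_commutator (Subgroup.mem_top g) (Subgroup.mem_top h)

theorem commutatorPairing_pow (a b : G) (u : ℕ) :
    commutatorPairing φ hφ ⟨⁅b, a ^ u⁆, commutatorElement_mem_commutator _ _⟩
      = commutatorPairing φ hφ ⟨⁅b, a⁆, commutatorElement_mem_commutator _ _⟩ ^ u := by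
  induction u with
  | zero =>
    refine (Eq.trans ?_ (map_one (commutatorPairing φ hφ))).trans (pow_zero _).symm
    congr 1
    apply Subtype.ext
    simp
  | succ u ih =>
    refine Eq.trans ?_ (pow_succ _ u).symm
    rw [← ih, ← commutatorPairing_conj φ hφ (a ^ u) ⟨⁅b, a⁆, _⟩, ← map_mul]
    congr 1
    apply Subtype.ext
    simp [commutatorElement_def, mul_assoc, pow_succ, -map_pow]

theorem commutatorPairing_swap (g h : G) :
    commutatorPairing φ hφ ⟨⁅g, h⁆, commutatorElement_mem_commutator _ _⟩
      = (commutatorPairing φ hφ ⟨⁅h, g⁆, commutatorElement_mem_commutator _ _⟩)⁻¹ := by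
  rw [← map_inv]
  congr 1
  apply Subtype.ext
  simp

/-- The kernel of `φ` is normal in `G`, and `γ₃(G)` is the normal closure of `[[b, a], a]` and `[[b,
a], b]`. -/
theorem eq_one_of_commutatorPairing {a b : G} (hab : Subgroup.closure {a, b} = ⊤)
    (ha : commutatorPairing φ hφ ⟨⁅b, a⁆, commutatorElement_mem_commutator _ _⟩ a = 1)
    (hb : commutatorPairing φ hφ ⟨⁅b, a⁆, commutatorElement_mem_commutator _ _⟩ b = 1) :
    φ = 1 := by
  have hN : (φ.ker.map (gammaThree G).subtype).Normal := by
    refine ⟨?_⟩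
    rintro _ ⟨x, hx, rfl⟩ h
    exact ⟨MulAut.conjNormal h x, (hφ h x).trans hx, rfl⟩
  have hle : gammaThree G ≤ φ.ker.map (gammaThree G).subtype :=
    commutator_commutator_le_of_closure_pair (Set.pair_comm a b ▸ hab) _
      ⟨_, hb, rfl⟩ ⟨_, ha, rfl⟩
  ext x
  obtain ⟨y, hy, hyx⟩ := hle x.2
  obtain rfl : y = x := Subtype.ext hyx
  exact hy

end Pairing

/-! ### Generalities on `p`-groups and torsion groups -/

theorem exists_pow_pow_eq_self {G : Type*} [Group G] {p : ℕ} [Fact p.Prime] (hG : IsPGroup p G)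
    (a : G) {u : ℕ} (hu : (u : ZMod p) ≠ 0) : ∃ k : ℕ, (a ^ u) ^ k = a := by
  refine exists_pow_eq_self_of_coprime (Nat.Coprime.symm (hG.orderOf_coprime ?_ a))
  rwa [(Fact.out : p.Prime).coprime_iff_not_dvd, ← ZMod.natCast_eq_zero_iff]

theorem isPGroup_pi {p : ℕ} {I G : Type*} [Fintype I] [Group G] (hG : IsPGroup p G) :
    IsPGroup p (I → G) := by
  intro f
  choose k hk using fun x => hG (f x)
  refine ⟨∑ x, k x, funext fun x => ?_⟩
  obtain ⟨c, hc⟩ := pow_dvd_pow p (Finset.single_le_sum (fun i _ => Nat.zero_le (k i))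
    (Finset.mem_univ x))
  change f x ^ _ = 1
  rw [hc, pow_mul, hk, one_pow]

/-- Both `G / G'` and `G' / γ₃(G)` are finitely generated torsion abelian groups, the second because
`G'` has finite index and so is finitely generated. -/
theorem finiteIndex_gammaThree {G : Type*} [Group G] [Group.FG G]
    (hG : ∀ g : G, IsOfFinOrder g) : (gammaThree G).FiniteIndex := by
  have h1 : (commutator G).FiniteIndex := finiteIndex_of_commutator_le hG le_rfl
  have hle : gammaThree G ≤ commutator G := Subgroup.commutator_le_left _ _
  have h3 : commutator (commutator G) ≤ (gammaThree G).subgroupOf (commutator G) :=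
    Subgroup.commutator_le.2 fun x _ y _ =>
      Subgroup.commutator_mem_commutator x.2 (Subgroup.mem_top (y : G))
  have : Group.FG (commutator G) :=
    Subgroup.fg_of_index_ne_zero _
  have h4 : ((gammaThree G).subgroupOf (commutator G)).FiniteIndex :=
    finiteIndex_of_commutator_le (T := commutator G)
      (fun t => Submonoid.isOfFinOrder_coe.1 (hG (t : G))) h3
  refine ⟨?_⟩
  rw [← Subgroup.relIndex_mul_index hle]
  exact mul_ne_zero h4.index_ne_zero h1.index_ne_zero

/-! ### Abstract wreath recursion -/

/-- The wreath recursion of a GGS-group `G = ⟨a, b⟩`, with the first level of the tree identified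
with a cyclic group `I` generated by `w`: `perm` is the action on the first level, `sec g x` is the
section of `g` at the vertex `x`, the section of `b` at `-w` is `b`, and the section of `b` at
`s - w` is `a ^ ε s` for `s ≠ 0`. -/
structure GGSRecursion (G I : Type*) [Group G] [AddCommGroup I] where
  perm : G →* Equiv.Perm I
  sec : G → I → G
  sec_mul : ∀ g h x, sec (g * h) x = sec g (perm h x) * sec h x
  a : G
  b : G
  w : I
  ε : I → ℕ
  closure_eq : Subgroup.closure {a, b} = ⊤
  perm_a : ∀ x, perm a x = x + w
  perm_b : perm b = 1
  sec_a : ∀ x, sec a x = 1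
  sec_b_last : sec b (-w) = b
  sec_b : ∀ x, x + w ≠ 0 → sec b x = a ^ ε (x + w)
  ε_zero : ε 0 = 0
  mem_zmultiples : ∀ x, x ∈ AddSubgroup.zmultiples w
  faithful : ∀ P : Set G, (∀ g ∈ P, perm g = 1 ∧ ∀ x, sec g x ∈ P) → ∀ g ∈ P, g = 1

namespace GGSRecursion

variable {G I : Type*} [Group G] [AddCommGroup I] (S : GGSRecursion G I)

theorem perm_apply (g : G) : ∃ v, ∀ x, S.perm g x = x + v := by
  have hg : g ∈ Subgroup.closure {S.a, S.b} := S.closure_eq ▸ Subgroup.mem_top g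
  induction hg using Subgroup.closure_induction with
  | mem g hg =>
    rcases hg with rfl | rfl
    · exact ⟨S.w, S.perm_a⟩
    · exact ⟨0, fun x => by rw [S.perm_b, add_zero]; rfl⟩
  | one => exact ⟨0, fun x => by rw [map_one, add_zero]; rfl⟩
  | mul g h _ _ hg hh =>
    obtain ⟨v, hv⟩ := hg
    obtain ⟨u, hu⟩ := hh
    exact ⟨u + v, fun x => by rw [map_mul, Equiv.Perm.mul_apply, hu, hv, add_assoc]⟩
  | inv g _ hg =>
    obtain ⟨v, hv⟩ := hg
    exact ⟨-v, fun x => by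
      rw [map_inv, Equiv.Perm.inv_eq_iff_eq, hv, neg_add_cancel_right]⟩

theorem perm_inv_perm (g : G) (x : I) : S.perm g⁻¹ (S.perm g x) = x := by
  rw [map_inv]; exact (S.perm g).symm_apply_apply x

theorem perm_perm_inv (g : G) (x : I) : S.perm g (S.perm g⁻¹ x) = x := by
  rw [map_inv]; exact (S.perm g).apply_symm_apply x

theorem perm_pow_apply {g : G} {v : I} (hg : ∀ x, S.perm g x = x + v) (k : ℕ) (x : I) :
    S.perm (g ^ k) x = x + k • v := by
  induction k with
  | zero => simp
  | succ k ih => rw [pow_succ', map_mul, Equiv.Perm.mul_apply, ih, hg, succ_nsmul, add_assoc]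

theorem perm_commutatorElement (g h : G) : S.perm ⁅g, h⁆ = 1 := by
  obtain ⟨u, hu⟩ := S.perm_apply g
  obtain ⟨v, hv⟩ := S.perm_apply h
  rw [map_commutatorElement, commutatorElement_eq_one_iff_mul_comm]
  ext x
  simp only [Equiv.Perm.mul_apply, hu, hv]
  abel

theorem commutator_le_ker : commutator G ≤ S.perm.ker :=
  Subgroup.commutator_le.2 fun g _ h _ => S.perm_commutatorElement g h

theorem sec_one (x : I) : S.sec 1 x = 1 := by
  have h := S.sec_mul 1 1 x
  rwa [mul_one, map_one, Equiv.Perm.one_apply, left_eq_mul] at h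

theorem sec_inv_apply (g : G) (x : I) : S.sec g⁻¹ (S.perm g x) = (S.sec g x)⁻¹ := by
  rw [eq_inv_iff_mul_eq_one, ← S.sec_mul, inv_mul_cancel, sec_one]

/-- The section at `x` as a homomorphism on the stabilizer of the first level. -/
def secHom (x : I) : S.perm.ker →* G :=
  MonoidHom.mk' (fun g => S.sec g x) fun g h => by
    have h1 : S.perm (h : G) = 1 := h.2
    rw [Subgroup.coe_mul, S.sec_mul, h1, Equiv.Perm.one_apply]

theorem sec_commutatorElement {g h : G} (hg : S.perm g = 1) (hh : S.perm h = 1) (x : I) :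
    S.sec ⁅g, h⁆ x = ⁅S.sec g x, S.sec h x⁆ :=
  map_commutatorElement (S.secHom x) (⟨g, hg⟩ : S.perm.ker) ⟨h, hh⟩

theorem exists_rotation (i : I) : ∃ t, (∀ x, S.perm t x = x + i) ∧ ∀ x, S.sec t x = 1 := by
  obtain ⟨k, rfl⟩ := S.mem_zmultiples i
  change ∃ t, (∀ x, S.perm t x = x + k • S.w) ∧ ∀ x, S.sec t x = 1
  induction k with
  | zero => exact ⟨1, fun x => by simp, S.sec_one⟩
  | succ k ih =>
    obtain ⟨t, ht, hs⟩ := ih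
    refine ⟨S.a * t, fun x => ?_, fun x => ?_⟩
    · rw [map_mul, Equiv.Perm.mul_apply, ht, S.perm_a, add_smul, one_smul, add_assoc]
    · rw [S.sec_mul, hs, S.sec_a, one_mul]
  | pred k ih =>
    obtain ⟨t, ht, hs⟩ := ih
    refine ⟨S.a⁻¹ * t, fun x => ?_, fun x => ?_⟩
    · rw [map_mul, Equiv.Perm.mul_apply, ht, map_inv, Equiv.Perm.inv_eq_iff_eq, S.perm_a,
        sub_smul, one_smul, add_assoc, sub_add_cancel]
    · rw [S.sec_mul, hs, mul_one, ← (S.perm S.a).apply_symm_apply (S.perm t x), sec_inv_apply,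
        S.sec_a, inv_one]

theorem perm_conj (t : G) {g : G} (hg : S.perm g = 1) : S.perm (t * g * t⁻¹) = 1 := by
  simp [hg]

theorem sec_conj_rotation {t : G} {i : I} (ht : ∀ x, S.perm t x = x + i)
    (hs : ∀ x, S.sec t x = 1) (g : G) (x : I) :
    S.sec (t * g * t⁻¹) (x + i) = S.sec g x := by
  rw [← ht, S.sec_mul, sec_inv_apply, S.sec_mul, hs, hs, S.perm_inv_perm, inv_one,
    mul_one, one_mul]

/-- The conjugates of `b` by the powers of `a`, numbered by the position of the section `b`. -/
theorem exists_directed (i : I) : ∃ β : G, S.perm β = 1 ∧ S.sec β i = S.b ∧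
    ∀ j, j ≠ i → S.sec β j = S.a ^ S.ε (j - i) := by
  -- The section `b` of `b` sits at `-w`; rotating by `i + w` moves it to `i`.
  obtain ⟨t, ht, hs⟩ := S.exists_rotation (i + S.w)
  refine ⟨t * S.b * t⁻¹, S.perm_conj t S.perm_b, ?_, fun j hj => ?_⟩
  · have h := S.sec_conj_rotation ht hs S.b (-S.w)
    rwa [S.sec_b_last, add_comm i, neg_add_cancel_left] at h
  · have h := S.sec_conj_rotation ht hs S.b (j - (i + S.w))
    have h1 : j - (i + S.w) + S.w = j - i := by abel
    rwa [sub_add_cancel, S.sec_b _ (by rw [h1]; exact sub_ne_zero.2 hj), h1] at h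

/-! ### Prescribing the section at one vertex -/

variable {p : ℕ} [Fact p.Prime]

theorem closure_pow_pair (hG : IsPGroup p G) {u : ℕ} (hu : (u : ZMod p) ≠ 0) :
    Subgroup.closure {S.b, S.a ^ u} = ⊤ := by
  rw [eq_top_iff, ← S.closure_eq, Subgroup.closure_le]
  rintro g (rfl | rfl)
  · obtain ⟨k, hk⟩ := exists_pow_pow_eq_self hG S.a hu
    have h := Subgroup.pow_mem _ (Subgroup.subset_closure
      (show S.a ^ u ∈ ({S.b, S.a ^ u} : Set G) from Or.inr rfl)) k
    rwa [hk] at h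
  · exact Subgroup.subset_closure (Or.inl rfl)

/-- The conjugates of `b` positioned at `x` and `x - s` have sections `b` and `a ^ ε s` at `x`.
These generate `G`, since `ε s` is prime to the order of `a`. -/
theorem secHom_surjective (hG : IsPGroup p G) {s : I} (hs : (S.ε s : ZMod p) ≠ 0) (x : I) :
    Function.Surjective (S.secHom x) := by
  have hs0 : s ≠ 0 := by
    rintro rfl
    exact hs (by rw [S.ε_zero, Nat.cast_zero])
  rw [← MonoidHom.range_eq_top, eq_top_iff, ← S.closure_pow_pair hG hs, Subgroup.closure_le]
  rintro g (rfl | rfl)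
  · obtain ⟨β, h1, h2, -⟩ := S.exists_directed x
    exact ⟨⟨β, h1⟩, h2⟩
  · obtain ⟨β, h1, -, h3⟩ := S.exists_directed (x - s)
    refine ⟨⟨β, h1⟩, (h3 x fun h => hs0 ?_).trans ?_⟩
    · exact sub_eq_self.1 h.symm
    · rw [sub_sub_cancel]

/-- Every element of `G'` is the section at `i` of an element of `G'` whose other sections, up to
the one at `i + d`, are trivial. -/
theorem exists_commutator_sec (hG : IsPGroup p G) {d : I} (hd : (S.ε (-d) : ZMod p) ≠ 0) (i : I)
    {x : G} (hx : x ∈ commutator G) :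
    ∃ g ∈ commutator G, S.sec g i = x ∧ ∀ j, j ≠ i → j ≠ i + d → S.sec g j = 1 := by
  have hd0 : d ≠ 0 := by
    rintro rfl
    exact hd (by rw [neg_zero, S.ε_zero, Nat.cast_zero])
  let M : Subgroup S.perm.ker := (commutator G).subgroupOf S.perm.ker ⊓
    ⨅ j : {j // j ≠ i ∧ j ≠ i + d}, (S.secHom j).ker
  have hker : (⨅ j : {j // j ≠ i ∧ j ≠ i + d}, (S.secHom j).ker).Normal :=
    Subgroup.normal_iInf_normal fun j => inferInstance
  have hM : M.Normal := Subgroup.normal_inf_normal _ _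
  -- The image is normal in `G`, so it contains `G'` once it contains the commutator of one
  -- generating pair, here `b` and `a ^ ε (-d)`.
  have hN : (M.map (S.secHom i)).Normal := hM.map _ (S.secHom_surjective hG hd i)
  obtain ⟨β, h1, h2, h3⟩ := S.exists_directed i
  obtain ⟨β', h1', h2', h3'⟩ := S.exists_directed (i + d)
  have hid : i ≠ i + d := fun h => hd0 (left_eq_add.1 h)
  have hmem : ⁅S.b, S.a ^ S.ε (-d)⁆ ∈ M.map (S.secHom i) := by
    refine ⟨⟨⁅β, β'⁆, S.perm_commutatorElement _ _⟩, ⟨?_, ?_⟩, ?_⟩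
    · exact commutatorElement_mem_commutator β β'
    · refine Subgroup.mem_iInf.2 ?_
      rintro ⟨j, hj, hj'⟩
      change S.sec ⁅β, β'⁆ j = 1
      rw [S.sec_commutatorElement h1 h1', h3 j hj, h3' j hj',
        commutatorElement_eq_one_iff_commute]
      exact (Commute.refl S.a).pow_pow _ _
    · change S.sec ⁅β, β'⁆ i = _
      rw [S.sec_commutatorElement h1 h1', h2, h3' i hid, sub_add_cancel_left]
  obtain ⟨g, ⟨hg, hg'⟩, rfl⟩ := commutator_le_of_closure_pair (S.closure_pow_pair hG hd) _ hmem hx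
  exact ⟨g, hg, rfl, fun j hj hj' => (Subgroup.mem_iInf.1 hg') ⟨j, hj, hj'⟩⟩

/-! ### The part of `γ₃(G)^I` realized by `γ₃(G)` -/

/-- `G` acts on `γ₃(G)^I` like it acts by conjugation on the stabilizer of the first level. -/
@[reducible] def gammaThreeAction : MulDistribMulAction G (I → gammaThree G) where
  smul g k := fun x => MulAut.conjNormal (S.sec g (S.perm g⁻¹ x)) (k (S.perm g⁻¹ x))
  one_smul k := funext fun x => by
    change MulAut.conjNormal (S.sec 1 (S.perm 1⁻¹ x)) (k (S.perm 1⁻¹ x)) = k x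
    simp [S.sec_one]
  mul_smul g h k := funext fun x => by
    change MulAut.conjNormal (S.sec (g * h) (S.perm (g * h)⁻¹ x)) (k (S.perm (g * h)⁻¹ x))
      = MulAut.conjNormal (S.sec g (S.perm g⁻¹ x)) (MulAut.conjNormal
        (S.sec h (S.perm h⁻¹ (S.perm g⁻¹ x))) (k (S.perm h⁻¹ (S.perm g⁻¹ x))))
    rw [S.sec_mul, map_mul, MulAut.mul_apply]
    have h1 : S.perm (g * h)⁻¹ x = S.perm h⁻¹ (S.perm g⁻¹ x) := by simp
    have h2 : S.perm h (S.perm (g * h)⁻¹ x) = S.perm g⁻¹ x := by simp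
    rw [h2, h1]
  smul_one g := funext fun x => map_one _
  smul_mul g k l := funext fun x => map_mul _ _ _

/-- The elements of `γ₃(G)^I` in the image of `γ₃(G)`. -/
def branchSubgroup : Subgroup (I → gammaThree G) where
  carrier := {k | ∃ g ∈ gammaThree G, ∀ x, S.sec g x = k x}
  one_mem' := ⟨1, Subgroup.one_mem _, S.sec_one⟩
  mul_mem' := by
    rintro k l ⟨g, hg, hk⟩ ⟨h, hh, hl⟩
    refine ⟨g * h, Subgroup.mul_mem _ hg hh, fun x => ?_⟩
    have h1 : S.perm h = 1 := S.commutator_le_ker (Subgroup.commutator_le_left _ _ hh)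
    rw [S.sec_mul, h1, Equiv.Perm.one_apply, hk, hl]
    rfl
  inv_mem' := by
    rintro k ⟨g, hg, hk⟩
    refine ⟨g⁻¹, Subgroup.inv_mem _ hg, fun x => ?_⟩
    have h1 : S.perm g = 1 := S.commutator_le_ker (Subgroup.commutator_le_left _ _ hg)
    have h2 := S.sec_inv_apply g x
    rw [h1, Equiv.Perm.one_apply, hk] at h2
    exact h2

theorem smul_mem_branchSubgroup (g : G) {k : I → gammaThree G} (hk : k ∈ S.branchSubgroup) :
    (letI := S.gammaThreeAction; g • k) ∈ S.branchSubgroup := by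
  obtain ⟨h, hh, hk⟩ := hk
  have h1 : S.perm h = 1 := S.commutator_le_ker (Subgroup.commutator_le_left _ _ hh)
  refine ⟨g * h * g⁻¹, Subgroup.Normal.conj_mem inferInstance h hh g, fun x => ?_⟩
  have h2 : S.sec (g * h * g⁻¹) (S.perm g (S.perm g⁻¹ x)) = S.sec g (S.perm g⁻¹ x)
      * S.sec h (S.perm g⁻¹ x) * (S.sec g (S.perm g⁻¹ x))⁻¹ := by
    rw [S.sec_mul, S.sec_inv_apply, S.sec_mul, S.perm_inv_perm, h1]
    rfl
  rw [S.perm_perm_inv, hk] at h2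
  exact h2

theorem rotation_smul_mulSingle [DecidableEq I] {t : G} {i : I} (ht : ∀ x, S.perm t x = x + i)
    (hs : ∀ x, S.sec t x = 1) (g : gammaThree G) :
    (letI := S.gammaThreeAction; t • (Pi.mulSingle 0 g : I → gammaThree G)) = Pi.mulSingle i g := by
  funext x
  change MulAut.conjNormal (S.sec t _) ((Pi.mulSingle 0 g : I → gammaThree G) (S.perm t⁻¹ x)) = _
  have h : S.perm t⁻¹ x = x - i := by
    rw [map_inv, Equiv.Perm.inv_eq_iff_eq, ht, sub_add_cancel]
  rw [hs, map_one, h, MulAut.one_apply]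
  by_cases hx : x = i
  · subst hx; simp
  · rw [Pi.mulSingle_eq_of_ne hx, Pi.mulSingle_eq_of_ne (sub_ne_zero.2 hx)]

theorem stabilizer_smul_mulSingle [DecidableEq I] {s : G} (hs : S.perm s = 1) (i : I)
    (g : gammaThree G) :
    (letI := S.gammaThreeAction; s • (Pi.mulSingle i g : I → gammaThree G))
      = Pi.mulSingle i (MulAut.conjNormal (S.sec s i) g) := by
  funext x
  change MulAut.conjNormal (S.sec s (S.perm s⁻¹ x))
    ((Pi.mulSingle i g : I → gammaThree G) (S.perm s⁻¹ x)) = _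
  have h : S.perm s⁻¹ x = x := by rw [map_inv, hs]; rfl
  rw [h]
  by_cases hx : x = i
  · subst hx; simp
  · rw [Pi.mulSingle_eq_of_ne hx, Pi.mulSingle_eq_of_ne hx, map_one]

/-- Realize `k i` and `l i` as sections at `i` of elements of `G'` supported on `{i, i + d}` and
`{i, i + d'}`. The supports meet only at `i`, so the commutator is concentrated there, and it lies
in `γ₃(G)`. -/
theorem commutator_le_branchSubgroup [Finite I] (hG : IsPGroup p G) {d d' : I} (hdd' : d ≠ d')
    (hd : (S.ε (-d) : ZMod p) ≠ 0) (hd' : (S.ε (-d') : ZMod p) ≠ 0) :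
    commutator (I → gammaThree G) ≤ S.branchSubgroup := by
  classical
  rw [commutator_def, Subgroup.commutator_le]
  intro k _ l _
  refine Subgroup.pi_mem_of_mulSingle_mem _ fun i => ?_
  have hle : gammaThree G ≤ commutator G := Subgroup.commutator_le_left _ _
  obtain ⟨g, hg, hgi, hgj⟩ := S.exists_commutator_sec hG hd i (hle (k i).2)
  obtain ⟨h, hh, hhi, hhj⟩ := S.exists_commutator_sec hG hd' i (hle (l i).2)
  refine ⟨⁅g, h⁆, Subgroup.commutator_mem_commutator hg (Subgroup.mem_top h), fun j => ?_⟩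
  rw [S.sec_commutatorElement (S.commutator_le_ker hg) (S.commutator_le_ker hh)]
  by_cases hji : j = i
  · subst hji
    rw [hgi, hhi, Pi.mulSingle_eq_same]
    rfl
  rw [Pi.mulSingle_eq_of_ne hji]
  by_cases hjd : j = i + d
  · rw [hhj j hji (fun h => hdd' (add_left_cancel (hjd.symm.trans h)))]
    simp
  · rw [hgj j hji hjd]
    simp

end GGSRecursion

/-! ### Vanishing of invariant characters -/

namespace GGSRecursion

variable {G I : Type*} [Group G] [AddCommGroup I] (S : GGSRecursion G I)
  {p : ℕ} [Fact p.Prime]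

/-- The sections of `[[b_0, b_d], b_k]`, where `b_i` is the conjugate of `b` with section `b` at
`i`. -/
theorem mulSingle_mul_mulSingle_mem_branchSubgroup [DecidableEq I] {d : I} (hd : d ≠ 0) {β : G}
    (hβ : S.perm β = 1) :
    (Pi.mulSingle 0 ⟨⁅⁅S.b, S.a ^ S.ε (-d)⁆, S.sec β 0⁆,
        commutatorElement_mem_gammaThree ⟨_, commutatorElement_mem_commutator _ _⟩ _⟩
      * Pi.mulSingle d ⟨⁅⁅S.a ^ S.ε d, S.b⁆, S.sec β d⁆,
        commutatorElement_mem_gammaThree ⟨_, commutatorElement_mem_commutator _ _⟩ _⟩ :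
      I → gammaThree G) ∈ S.branchSubgroup := by
  obtain ⟨β₀, h1, h2, h3⟩ := S.exists_directed 0
  obtain ⟨β', h1', h2', h3'⟩ := S.exists_directed d
  refine ⟨⁅⁅β₀, β'⁆, β⁆, Subgroup.commutator_mem_commutator
    (commutatorElement_mem_commutator _ _) (Subgroup.mem_top _), fun j => ?_⟩
  rw [S.sec_commutatorElement (S.perm_commutatorElement _ _) hβ, S.sec_commutatorElement h1 h1']
  by_cases hj0 : j = 0
  · subst hj0
    rw [h2, h3' 0 hd.symm, zero_sub, Pi.mul_apply, Pi.mulSingle_eq_same,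
      Pi.mulSingle_eq_of_ne hd.symm, mul_one]
  by_cases hjd : j = d
  · subst hjd
    rw [h2', h3 j hj0, sub_zero, Pi.mul_apply, Pi.mulSingle_eq_same,
      Pi.mulSingle_eq_of_ne hj0, one_mul]
  · have hc : ⁅S.sec β₀ j, S.sec β' j⁆ = 1 := by
      rw [h3 j hj0, h3' j hjd, commutatorElement_eq_one_iff_commute]
      exact (Commute.refl S.a).pow_pow _ _
    rw [Pi.mul_apply, Pi.mulSingle_eq_of_ne hj0, Pi.mulSingle_eq_of_ne hjd, hc]
    simp

theorem eq_one_of_invariant [Fintype I] (hG : IsPGroup p G) (hI : ∃ n, Fintype.card I = p ^ n)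
    (hsum : ∑ x, (S.ε x : ZMod p) = 0) {d : I} (hd : (S.ε (-d) : ZMod p) ≠ 0)
    (χ : (I → gammaThree G) →* Multiplicative (ZMod p)) (hχ : ∀ k ∈ S.branchSubgroup, χ k = 1)
    (hinv : letI := S.gammaThreeAction
      ∀ (g : G) (k : I → gammaThree G), χ (g • k) = χ k) : χ = 1 := by
  classical
  have hd0 : d ≠ 0 := by
    rintro rfl
    exact hd (by rw [neg_zero, S.ε_zero, Nat.cast_zero])
  let φ : gammaThree G →* Multiplicative (ZMod p) :=
    χ.comp (MonoidHom.mulSingle (fun _ => gammaThree G) 0)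
  have hφi : ∀ i g, χ (Pi.mulSingle i g) = φ g := by
    intro i g
    obtain ⟨t, ht, hs⟩ := S.exists_rotation i
    rw [← S.rotation_smul_mulSingle ht hs, hinv]
    rfl
  have hφ : ∀ (h : G) (x : gammaThree G), φ (MulAut.conjNormal h x) = φ x := by
    intro h x
    obtain ⟨⟨s, hs⟩, rfl⟩ := S.secHom_surjective hG hd 0 h
    have h1 := S.stabilizer_smul_mulSingle hs 0 x
    change χ (Pi.mulSingle 0 (MulAut.conjNormal (S.sec s 0) x)) = χ (Pi.mulSingle 0 x)
    rw [← h1, hinv]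
  let P := commutatorPairing φ hφ
  let c := P ⟨⁅S.b, S.a⁆, commutatorElement_mem_commutator _ _⟩
  let L : G → ZMod p := fun g => (c g).toAdd
  -- `χ` kills the triple commutator with sections at `0` and `d` only; the sign comes from the
  -- order of `a` and `b` in the section at `d`.
  have hrel : ∀ β, S.perm β = 1 → (S.ε (-d) : ZMod p) * L (S.sec β 0) = S.ε d * L (S.sec β d) := by
    intro β hβ
    have h1 := hχ _ (S.mulSingle_mul_mulSingle_mem_branchSubgroup hd0 hβ)
    rw [map_mul, hφi, hφi] at h1
    change P ⟨⁅S.b, S.a ^ S.ε (-d)⁆, commutatorElement_mem_commutator _ _⟩ (S.sec β 0)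
      * P ⟨⁅S.a ^ S.ε d, S.b⁆, commutatorElement_mem_commutator _ _⟩ (S.sec β d) = 1 at h1
    have h2 : P ⟨⁅S.a ^ S.ε d, S.b⁆, commutatorElement_mem_commutator _ _⟩ = (c ^ S.ε d)⁻¹ := by
      rw [← commutatorPairing_pow φ hφ, commutatorPairing_swap φ hφ]
    have h3 : P ⟨⁅S.b, S.a ^ S.ε (-d)⁆, commutatorElement_mem_commutator _ _⟩ = c ^ S.ε (-d) :=
      commutatorPairing_pow φ hφ _ _ _
    rw [h2, h3, MonoidHom.inv_apply, mul_inv_eq_one, MonoidHom.pow_apply,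
      MonoidHom.pow_apply] at h1
    have h4 := congrArg Multiplicative.toAdd h1
    simpa only [toAdd_pow, nsmul_eq_mul] using h4
  have hL : ∀ u : ℕ, L (S.a ^ u) = u * L S.a := by
    intro u
    simp only [L, map_pow, toAdd_pow, nsmul_eq_mul]
  obtain ⟨β₀, h1, h2, h3⟩ := S.exists_directed 0
  obtain ⟨β', h1', h2', h3'⟩ := S.exists_directed d
  have e0 := hrel β₀ h1
  rw [h2, h3 d hd0, sub_zero, hL] at e0
  have ed := hrel β' h1'
  rw [h2', h3' 0 hd0.symm, zero_sub, hL] at ed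
  have ek : ∀ k, k ≠ 0 → k ≠ d →
      (S.ε (-d) : ZMod p) * (S.ε (-k) * L S.a) = S.ε d * (S.ε (d - k) * L S.a) := by
    intro k hk0 hkd
    obtain ⟨β, g1, -, g3⟩ := S.exists_directed k
    have h := hrel β g1
    rwa [g3 0 hk0.symm, g3 d hkd.symm, zero_sub, hL, hL] at h
  have hLa : L S.a = 0 := by
    by_contra hne
    refine sum_ne_zero_of_proportional_translates hI (fun x => (S.ε x : ZMod p))
      (by simp [S.ε_zero]) hd0 hd ?_ ?_ hsum
    -- Eliminating `L b` between `e0` and `ed` gives the equality of cubes.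
    · refine mul_right_cancel₀ hne ?_
      linear_combination -(S.ε d : ZMod p) * e0 - (S.ε (-d) : ZMod p) * ed
    · intro k hk0 hkd
      refine mul_right_cancel₀ hne ?_
      linear_combination ek k hk0 hkd
  have hLb : L S.b = 0 := by
    rw [hLa, mul_zero, mul_zero] at e0
    exact (mul_eq_zero.1 e0).resolve_left hd
  have hφ1 : φ = 1 := eq_one_of_commutatorPairing φ hφ S.closure_eq
    (Multiplicative.toAdd.injective hLa) (Multiplicative.toAdd.injective hLb)
  ext1 k
  refine Subgroup.pi_mem_of_mulSingle_mem (H := χ.ker) k fun i => ?_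
  rw [MonoidHom.mem_ker, hφi, hφ1]
  rfl

/-- A single nonzero term could not sum to zero. -/
theorem exists_two_units [Fintype I] (hsum : ∑ x, (S.ε x : ZMod p) = 0)
    (hε : ∃ s, (S.ε s : ZMod p) ≠ 0) :
    ∃ d d', d ≠ d' ∧ (S.ε (-d) : ZMod p) ≠ 0 ∧ (S.ε (-d') : ZMod p) ≠ 0 := by
  obtain ⟨s, hs⟩ := hε
  by_contra! H
  apply hs
  rw [← hsum, Fintype.sum_eq_single s]
  intro x hx
  have := H (-s) (-x) (fun h => hx (neg_injective h).symm)
  rw [neg_neg, neg_neg] at this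
  exact this hs

theorem group_fg (S : GGSRecursion G I) : Group.FG G :=
  Group.fg_iff.2 ⟨{S.a, S.b}, S.closure_eq, Set.toFinite _⟩

theorem branchSubgroup_eq_top [Fintype I] (hG : IsPGroup p G)
    (hI : ∃ n, Fintype.card I = p ^ n) (hsum : ∑ x, (S.ε x : ZMod p) = 0)
    (hε : ∃ s, (S.ε s : ZMod p) ≠ 0) : S.branchSubgroup = ⊤ := by
  obtain ⟨d, d', hdd', hd, hd'⟩ := S.exists_two_units hsum hε
  let := S.gammaThreeAction
  have := S.group_fg
  have : (gammaThree G).FiniteIndex :=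
    finiteIndex_gammaThree fun g => hG.isOfFinOrder (Fact.out : p.Prime).ne_zero g
  have h1 : Group.FG (gammaThree G) := Subgroup.fg_of_index_ne_zero _
  have : Group.FG (I → gammaThree G) := by
    have h2 := Subgroup.FG.pi (P := fun _ : I => (⊤ : Subgroup (gammaThree G))) fun _ => h1.out
    rw [Subgroup.pi_top] at h2
    exact ⟨h2⟩
  exact eq_top_of_forall_invariant_hom hG (isPGroup_pi (hG.to_subgroup _))
    (S.commutator_le_branchSubgroup hG hdd' hd hd')
    (fun g k hk => S.smul_mem_branchSubgroup g hk)
    (fun χ hχ hinv => S.eq_one_of_invariant hG hI hsum hd χ hχ hinv)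

/-! ### Consequences of periodicity, and nontriviality of `γ₃(G)` -/

theorem isPGroup_of_torsion (S : GGSRecursion G I) [Fintype I] (hI : ∃ n, Fintype.card I = p ^ n)
    (hfin : ∀ g : G, IsOfFinOrder g) : IsPGroup p G := by
  have hp : p.Prime := Fact.out
  have key : ∀ g : G, ∀ q : ℕ, p.Coprime q → g ^ q = 1 → g = 1 := by
    intro g q hq hg
    -- Such a `g` translates the first level by a vector killed by `q`, hence by `0`; its sections
    -- then satisfy the same equation.
    refine S.faithful {g | g ^ q = 1} (fun g hg => ?_) g hg
    have h1 : S.perm g = 1 := by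
      obtain ⟨v, hv⟩ := S.perm_apply g
      have h2 : q • v = 0 := by
        have := S.perm_pow_apply hv q 0
        rw [hg, map_one, zero_add] at this
        exact this.symm
      have h5 := eq_zero_of_coprime_nsmul hI hq h2
      ext x
      rw [hv, h5, add_zero]
      rfl
    refine ⟨h1, fun x => ?_⟩
    have h6 : S.secHom x ((⟨g, h1⟩ : S.perm.ker) ^ q) = S.sec g x ^ q := map_pow (S.secHom x) _ q
    have h7 : (⟨g, h1⟩ : S.perm.ker) ^ q = 1 := Subtype.ext hg
    rw [h7, map_one] at h6
    exact h6.symm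
  rw [IsPGroup.iff_orderOf]
  intro g
  obtain ⟨k, q, hq, hk⟩ := Nat.exists_eq_pow_mul_and_not_dvd (hfin g).orderOf_pos.ne' p hp.ne_one
  refine ⟨k, ?_⟩
  have h1 : g ^ p ^ k = 1 := key _ q ((hp.coprime_iff_not_dvd).2 hq) (by
    rw [← pow_mul, ← hk, pow_orderOf_eq_one])
  exact Nat.dvd_antisymm (orderOf_dvd_of_pow_eq_one h1) (hk ▸ dvd_mul_right _ _)

theorem coprime_of_natCast_ne_zero {u : ℕ} (hu : (u : ZMod p) ≠ 0) : p.Coprime u := by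
  rwa [(Fact.out : p.Prime).coprime_iff_not_dvd, ← ZMod.natCast_eq_zero_iff]

theorem sec_a_pow (k : ℕ) (x : I) : S.sec (S.a ^ k) x = 1 := by
  induction k with
  | zero => rw [pow_zero, sec_one]
  | succ k ih => rw [pow_succ', S.sec_mul, ih, S.sec_a, one_mul]

/-- Otherwise all sections of `b` are trivial, so `a ^ ε s = 1` with `ε s` prime to `p`, and `a`
would fix the first level. -/
theorem b_mul_a_pow_ne [Fintype I] (hI : ∃ n, Fintype.card I = p ^ n)
    (hε : ∃ s, (S.ε s : ZMod p) ≠ 0) (j k : ℕ) : S.b * S.a ^ j ≠ S.a ^ k := by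
  intro h
  have hsec : ∀ x, S.sec S.b x = 1 := by
    intro x
    have h1 := S.sec_mul S.b (S.a ^ j) (S.perm (S.a ^ j)⁻¹ x)
    rw [h, sec_a_pow, sec_a_pow, S.perm_perm_inv, mul_one] at h1
    exact h1.symm
  obtain ⟨s, hs⟩ := hε
  have hs0 : s ≠ 0 := by
    rintro rfl
    exact hs (by rw [S.ε_zero, Nat.cast_zero])
  have h1 : S.a ^ S.ε s = 1 := by
    have h2 := S.sec_b (s - S.w) (by rwa [sub_add_cancel])
    rw [hsec, sub_add_cancel] at h2
    exact h2.symm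
  have h2 : S.ε s • S.w = 0 := by
    have h3 := S.perm_pow_apply S.perm_a (S.ε s) 0
    rw [h1, map_one, zero_add] at h3
    exact h3.symm
  have h3 : S.w = 0 := eq_zero_of_coprime_nsmul hI (coprime_of_natCast_ne_zero hs) h2
  obtain ⟨k, hk⟩ := S.mem_zmultiples s
  exact hs0 (by rw [← hk, h3]; exact smul_zero k)

/-- If `γ₃(G) = 1`, then `[b, a]` commutes with `a` and has equal sections at all vertices.
Comparing those at `-w` and `w` puts `b` in `⟨a⟩`. -/
theorem gammaThree_ne_bot [Fintype I] (hI : ∃ n, Fintype.card I = p ^ n)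
    (hsum : ∑ x, (S.ε x : ZMod p) = 0) (hε : ∃ s, (S.ε s : ZMod p) ≠ 0) : gammaThree G ≠ ⊥ := by
  intro hbot
  obtain ⟨d, d', hdd', hd, hd'⟩ := S.exists_two_units hsum hε
  have hne : ∀ d : I, (S.ε (-d) : ZMod p) ≠ 0 → d ≠ 0 := by
    rintro _ hd rfl
    exact hd (by rw [neg_zero, S.ε_zero, Nat.cast_zero])
  -- If `2w = 0`, then `w` is the only possible nonzero position, which leaves no room for two
  -- units.
  have hww : S.w + S.w ≠ 0 := by
    intro hw
    have hx : ∀ x, x ≠ 0 → x = S.w := by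
      intro x hx
      obtain ⟨k, rfl⟩ := S.mem_zmultiples x
      change k • S.w ≠ 0 at hx
      change k • S.w = S.w
      have h2 : (2 : ℤ) • S.w = 0 := by rw [two_smul, hw]
      rcases Int.even_or_odd' k with ⟨l, rfl | rfl⟩
      · rw [mul_comm, mul_smul, h2, smul_zero] at hx
        exact absurd rfl hx
      · rw [add_smul, mul_comm, mul_smul, h2, smul_zero, one_smul, zero_add]
    exact hdd' ((hx d (hne d hd)).trans (hx d' (hne d' hd')).symm)
  have hw : S.w ≠ 0 := fun h => hww (by rw [h, add_zero])
  have hcomm : S.a * ⁅S.b, S.a⁆ * S.a⁻¹ = ⁅S.b, S.a⁆ := by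
    have h1 : ⁅⁅S.b, S.a⁆, S.a⁆ ∈ gammaThree G :=
      commutatorElement_mem_gammaThree ⟨_, commutatorElement_mem_commutator _ _⟩ _
    rw [hbot, Subgroup.mem_bot, commutatorElement_eq_one_iff_mul_comm] at h1
    rw [← h1, mul_inv_cancel_right]
  have hrot : ∀ x, S.sec ⁅S.b, S.a⁆ (x + S.w) = S.sec ⁅S.b, S.a⁆ x := by
    intro x
    have h1 := S.sec_conj_rotation S.perm_a S.sec_a ⁅S.b, S.a⁆ x
    rwa [hcomm] at h1
  have hsec : ∀ y, S.sec ⁅S.b, S.a⁆ (y + S.w) = S.sec S.b (y + S.w) * (S.sec S.b y)⁻¹ := by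
    intro y
    have h1 : ⁅S.b, S.a⁆ = S.b * (S.a * S.b⁻¹ * S.a⁻¹) := by
      simp [commutatorElement_def, mul_assoc]
    have h2 : S.perm (S.a * S.b⁻¹ * S.a⁻¹) = 1 :=
      S.perm_conj S.a (by rw [map_inv, S.perm_b, inv_one])
    have h3 := S.sec_inv_apply S.b y
    rw [S.perm_b, Equiv.Perm.one_apply] at h3
    rw [h1, S.sec_mul, h2, Equiv.Perm.one_apply, S.sec_conj_rotation S.perm_a S.sec_a, h3]
  have e1 := hsec (-S.w - S.w)
  have e2 := hsec 0
  rw [sub_add_cancel, S.sec_b_last, S.sec_b _ (by rwa [sub_add_cancel, neg_ne_zero])] at e1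
  rw [zero_add, S.sec_b _ hww, S.sec_b _ (by rwa [zero_add])] at e2
  have e3 : S.sec ⁅S.b, S.a⁆ (-S.w) = S.sec ⁅S.b, S.a⁆ S.w := by
    have h1 := hrot (-S.w)
    have h2 := hrot 0
    rw [neg_add_cancel] at h1
    rw [zero_add] at h2
    rw [h2, h1]
  rw [e1, e2, mul_inv_eq_iff_eq_mul] at e3
  refine S.b_mul_a_pow_ne hI hε (S.ε (0 + S.w)) (S.ε (S.w + S.w) + S.ε (-S.w - S.w + S.w)) ?_
  rw [e3, mul_assoc, mul_assoc, (Commute.refl S.a).pow_pow, inv_mul_cancel_left, ← pow_add]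

/-- If the sum `u` is a unit, `h = b a ^ u` acts on the first level as a full cycle, and the section
of `h ^ |I|` at `-w` is `h` again. So the order of `h` cannot be finite. -/
theorem sum_eq_zero_of_torsion [Fintype I] (hI : ∃ n, Fintype.card I = p ^ n)
    (hw : S.w ≠ 0) (hfin : ∀ g : G, IsOfFinOrder g) : ∑ x, (S.ε x : ZMod p) = 0 := by
  classical
  by_contra hne
  set u := ∑ x, S.ε x with hu
  have hu0 : (u : ZMod p) ≠ 0 := by rwa [hu, Nat.cast_sum]
  let v := u • S.w
  have hwcard : addOrderOf S.w = Fintype.card I := by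
    rw [addOrderOf_eq_card_of_forall_mem_zmultiples S.mem_zmultiples, Nat.card_eq_fintype_card]
  have hv : addOrderOf v = Fintype.card I := by
    rw [← hwcard]
    refine Nat.Coprime.addOrderOf_nsmul ?_
    obtain ⟨n, hn⟩ := hI
    rw [hwcard, hn]
    exact Nat.Coprime.pow_left n (coprime_of_natCast_ne_zero hu0)
  have hvgen : ∀ x, x ∈ AddSubgroup.zmultiples v := by
    have : AddSubgroup.zmultiples v = ⊤ := by
      refine AddSubgroup.eq_top_of_card_eq _ ?_
      rw [Nat.card_zmultiples, hv, Nat.card_eq_fintype_card]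
    intro x
    rw [this]
    exact AddSubgroup.mem_top x
  have hm1 : 1 < Fintype.card I := by
    rw [Fintype.one_lt_card_iff]
    exact ⟨S.w, 0, hw⟩
  -- Here `|I| = m + 1`: the first `m` steps of the cycle from `-w` collect `a ^ u`, the last one
  -- contributes `b`.
  obtain ⟨m, hm⟩ := Nat.exists_eq_succ_of_ne_zero (Nat.ne_of_gt (Nat.zero_lt_of_lt hm1))
  let h := S.b * S.a ^ u
  have hperm : ∀ x, S.perm h x = x + v := by
    intro x
    rw [map_mul, Equiv.Perm.mul_apply, S.perm_b, Equiv.Perm.one_apply,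
      S.perm_pow_apply S.perm_a]
  have hsec : ∀ x, S.sec h x = S.sec S.b (x + v) := by
    intro x
    rw [S.sec_mul, S.sec_a_pow, mul_one, S.perm_pow_apply S.perm_a]
  have hpow : ∀ j, S.sec (h ^ (j + 1)) (-S.w) = S.sec S.b (-S.w + (j + 1) • v)
      * S.sec (h ^ j) (-S.w) := by
    intro j
    rw [pow_succ', S.sec_mul, hsec, S.perm_pow_apply hperm, add_assoc, succ_nsmul]
  have hsum : ∀ j ≤ m, S.sec (h ^ j) (-S.w) = S.a ^ ∑ i ∈ Finset.range j, S.ε ((i + 1) • v) := by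
    intro j hj
    induction j with
    | zero => rw [pow_zero, sec_one, Finset.range_zero, Finset.sum_empty, pow_zero]
    | succ j ih =>
      have h1 : -S.w + (j + 1) • v + S.w = (j + 1) • v := by abel
      have h2 : (j + 1) • v ≠ 0 := by
        intro h2
        have h3 := Nat.le_of_dvd j.succ_pos (addOrderOf_dvd_of_nsmul_eq_zero h2)
        rw [hv, hm] at h3
        omega
      rw [hpow, ih (by omega), S.sec_b _ (by rwa [h1]), h1, ← pow_add, Finset.sum_range_succ,
        add_comm]
  have htotal : ∑ i ∈ Finset.range m, S.ε ((i + 1) • v) = u := by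
    have h1 : ∑ i ∈ Finset.range (m + 1), S.ε (i • v) = u := by
      rw [hu, ← IsAddCyclic.image_range_addOrderOf hvgen, hv, hm, Finset.sum_image]
      intro i hi j hj hij
      have hi' := Finset.mem_range.1 hi
      have hj' := Finset.mem_range.1 hj
      refine nsmul_injOn_Iio_addOrderOf ?_ ?_ hij
      · rw [hv, hm]; exact hi'
      · rw [hv, hm]; exact hj'
    rwa [Finset.sum_range_succ', zero_smul, S.ε_zero, add_zero] at h1
  have hsecm : S.sec (h ^ (m + 1)) (-S.w) = h := by
    have h1 : (m + 1) • v = 0 := by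
      rw [show m + 1 = addOrderOf v by rw [hv, hm]]
      exact addOrderOf_nsmul_eq_zero v
    rw [hpow, hsum m le_rfl, htotal, h1, add_zero, S.sec_b_last]
  have hpermm : S.perm (h ^ (m + 1)) = 1 := by
    ext x
    rw [S.perm_pow_apply hperm, show m + 1 = addOrderOf v by rw [hv, hm],
      addOrderOf_nsmul_eq_zero, add_zero]
    rfl
  have hk := (hfin h).orderOf_pos
  have hdvd : m + 1 ∣ orderOf h := by
    have h1 := S.perm_pow_apply hperm (orderOf h) 0
    rw [pow_orderOf_eq_one, map_one, zero_add] at h1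
    have h2 := addOrderOf_dvd_of_nsmul_eq_zero h1.symm
    rwa [hv, hm] at h2
  obtain ⟨j, hj⟩ := hdvd
  have hj1 : h ^ j = 1 := by
    have h1 : S.secHom (-S.w) ((⟨h ^ (m + 1), hpermm⟩ : S.perm.ker) ^ j)
        = S.sec (h ^ (m + 1)) (-S.w) ^ j := map_pow (S.secHom _) _ j
    have h2 : (⟨h ^ (m + 1), hpermm⟩ : S.perm.ker) ^ j = 1 := by
      refine Subtype.ext ?_
      change (h ^ (m + 1)) ^ j = 1
      rw [← pow_mul, ← hj, pow_orderOf_eq_one]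
    rw [h2, map_one, hsecm] at h1
    exact h1.symm
  have hj0 : 0 < j := by
    rcases Nat.eq_zero_or_pos j with rfl | h0
    · rw [mul_zero] at hj; omega
    · exact h0
  have h1 := Nat.le_of_dvd hj0 (orderOf_dvd_of_pow_eq_one hj1)
  rw [hj] at h1
  have h2 : 1 < m + 1 := by omega
  nlinarith

end GGSRecursion

/-! ### The concrete GGS-group on words -/

section Sections

variable {k : ℕ} (e : Fin (k + 1 - 1) → ZMod (k + 1))

theorem genA_mem : genA (k + 1) ∈ ggsGroup e := Subgroup.subset_closure (Or.inl rfl)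

theorem genB_mem : genB e ∈ ggsGroup e := Subgroup.subset_closure (Or.inr rfl)

theorem genA_cons (x : Fin (k + 1)) (z : List (Fin (k + 1))) :
    genA (k + 1) (x :: z) = (x + 1) :: z := by
  change finRotate (k + 1) x :: z = _
  rw [finRotate_apply]

theorem genB_cons (x : Fin (k + 1)) (z : List (Fin (k + 1))) :
    genB e (x :: z) = x ::
      (if h : (x : ℕ) < k + 1 - 1 then genA (k + 1) ^ (e ⟨x, h⟩).val else genB e) z := by
  have h := (genB_psi e).2 x z
  rw [(genB_psi e).1 [x] rfl] at h
  exact h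

theorem exists_sections {g : TreeAut (k + 1)} (hg : g ∈ ggsGroup e) :
    g [] = [] ∧ ∃ (σ : Equiv.Perm (Fin (k + 1))) (s : Fin (k + 1) → ggsGroup e),
      ∀ x z, g (x :: z) = σ x :: (s x : TreeAut (k + 1)) z := by
  induction hg using Subgroup.closure_induction with
  | mem g hg =>
    rcases hg with rfl | rfl
    · exact ⟨rfl, finRotate (k + 1), fun _ => 1, fun _ _ => rfl⟩
    · have hmem : ∀ x : Fin (k + 1), (if h : (x : ℕ) < k + 1 - 1 then
          genA (k + 1) ^ (e ⟨x, h⟩).val else genB e) ∈ ggsGroup e := by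
        intro x
        split_ifs
        · exact Subgroup.pow_mem _ (genA_mem e) _
        · exact genB_mem e
      exact ⟨rfl, 1, fun x => ⟨_, hmem x⟩, fun x z => genB_cons e x z⟩
  | one => exact ⟨rfl, 1, fun _ => 1, fun _ _ => rfl⟩
  | mul g h _ _ hg hh =>
    obtain ⟨hg0, σ, s, hs⟩ := hg
    obtain ⟨hh0, τ, t, ht⟩ := hh
    refine ⟨?_, σ * τ, fun x => s (τ x) * t x, fun x z => ?_⟩
    · rw [RelIso.mul_apply, hh0, hg0]
    · rw [RelIso.mul_apply, ht, hs]
      rfl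
  | inv g _ hg =>
    obtain ⟨hg0, σ, s, hs⟩ := hg
    refine ⟨?_, σ⁻¹, fun x => (s (σ⁻¹ x))⁻¹, fun x z => ?_⟩
    · apply g.injective
      rw [RelIso.apply_inv_self, hg0]
    · apply g.injective
      rw [RelIso.apply_inv_self, hs]
      have h1 : σ (σ⁻¹ x) = x := σ.apply_symm_apply x
      rw [h1, Subgroup.coe_inv, RelIso.apply_inv_self]

theorem apply_nil (g : ggsGroup e) : (g : TreeAut (k + 1)) [] = [] := (exists_sections e g.2).1

/-- The permutation of the first level induced by an element of a GGS-group. -/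
noncomputable def firstLevelPerm (g : ggsGroup e) : Equiv.Perm (Fin (k + 1)) :=
  (exists_sections e g.2).2.choose

/-- The section of an element of a GGS-group at a vertex of the first level. -/
noncomputable def firstLevelSection (g : ggsGroup e) : Fin (k + 1) → ggsGroup e :=
  (exists_sections e g.2).2.choose_spec.choose

theorem apply_cons (g : ggsGroup e) (x : Fin (k + 1)) (z : List (Fin (k + 1))) :
    (g : TreeAut (k + 1)) (x :: z) = firstLevelPerm e g x :: (firstLevelSection e g x).1 z :=
  (exists_sections e g.2).2.choose_spec.choose_spec x z

/-- Permutation and sections were obtained by choice; since the action determines them, they can be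
computed from it. -/
theorem perm_section_unique {g : ggsGroup e} {x y : Fin (k + 1)} {h : ggsGroup e}
    (H : ∀ z, (g : TreeAut (k + 1)) (x :: z) = y :: (h : TreeAut (k + 1)) z) :
    firstLevelPerm e g x = y ∧ firstLevelSection e g x = h := by
  have h1 : ∀ z, firstLevelPerm e g x = y ∧ (firstLevelSection e g x).1 z = h.1 z := by
    intro z
    have h2 := H z
    rw [apply_cons] at h2
    exact List.cons.inj h2
  exact ⟨(h1 []).1, Subtype.ext (RelIso.ext fun z => (h1 z).2)⟩

theorem perm_section_one (x : Fin (k + 1)) :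
    firstLevelPerm e 1 x = x ∧ firstLevelSection e 1 x = 1 :=
  perm_section_unique e fun _ => rfl

theorem perm_section_mul (g h : ggsGroup e) (x : Fin (k + 1)) :
    firstLevelPerm e (g * h) x = firstLevelPerm e g (firstLevelPerm e h x) ∧
    firstLevelSection e (g * h) x
      = firstLevelSection e g (firstLevelPerm e h x) * firstLevelSection e h x := by
  refine perm_section_unique e fun z => ?_
  rw [Subgroup.coe_mul, RelIso.mul_apply, apply_cons, apply_cons]
  rfl

theorem perm_section_genA (x : Fin (k + 1)) :
    firstLevelPerm e ⟨genA (k + 1), genA_mem e⟩ x = x + 1 ∧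
    firstLevelSection e ⟨genA (k + 1), genA_mem e⟩ x = 1 :=
  perm_section_unique e fun z => genA_cons x z

/-- The exponents of the sections of `b`, numbered so that the section `b` has number `0`. -/
def exponent (s : Fin (k + 1)) : ℕ :=
  -- The letter `s - 1` is the last one exactly when `s = 0`; the default there adds nothing to the
  -- sum of the exponents.
  if h : ((s - 1 : Fin (k + 1)) : ℕ) < k + 1 - 1 then (e ⟨_, h⟩).val else 0

theorem add_one_ne_zero_iff {x : Fin (k + 1)} : x + 1 ≠ 0 ↔ (x : ℕ) < k := by
  rw [← Fin.last_add_one, ne_eq, add_left_inj, ← ne_eq, ← Fin.lt_last_iff_ne_last]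
  rfl

theorem perm_section_genB (x : Fin (k + 1)) :
    firstLevelPerm e ⟨genB e, genB_mem e⟩ x = x ∧
    firstLevelSection e ⟨genB e, genB_mem e⟩ x =
      if x + 1 = 0 then ⟨genB e, genB_mem e⟩
      else ⟨genA (k + 1), genA_mem e⟩ ^ exponent e (x + 1) := by
  refine perm_section_unique e fun z => (genB_cons e x z).trans ?_
  congr 1
  by_cases hx : x + 1 = 0
  · have h1 : ¬ (x : ℕ) < k + 1 - 1 := fun h => add_one_ne_zero_iff.2 h hx
    rw [if_pos hx, dif_neg h1]
  · have h1 : (x : ℕ) < k + 1 - 1 := add_one_ne_zero_iff.1 hx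
    rw [if_neg hx, dif_pos h1, Subgroup.coe_pow]
    congr 3
    rw [exponent, dif_pos (by rwa [add_sub_cancel_right])]
    congr 2
    rw [Fin.mk.injEq, add_sub_cancel_right]

/-- The wreath recursion of a GGS-group. -/
noncomputable def ggsRecursion : GGSRecursion (ggsGroup e) (Fin (k + 1)) where
  perm :=
    { toFun := firstLevelPerm e
      map_one' := Equiv.ext fun x => (perm_section_one e x).1
      map_mul' := fun g h => Equiv.ext fun x => (perm_section_mul e g h x).1 }
  sec := firstLevelSection e
  sec_mul g h x := (perm_section_mul e g h x).2
  a := ⟨genA (k + 1), genA_mem e⟩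
  b := ⟨genB e, genB_mem e⟩
  w := 1
  ε := exponent e
  closure_eq := by
    refine Eq.trans ?_ (Subgroup.closure_closure_coe_preimage (k := {genA (k + 1), genB e}))
    congr 1
    ext ⟨g, hg⟩
    simp only [Set.mem_insert_iff, Set.mem_singleton_iff, Subtype.ext_iff]
    exact Iff.rfl
  perm_a x := (perm_section_genA e x).1
  perm_b := Equiv.ext fun x => (perm_section_genB e x).1
  sec_a x := (perm_section_genA e x).2
  sec_b_last := by
    rw [(perm_section_genB e _).2, if_pos (neg_add_cancel _)]
  sec_b x hx := by
    rw [(perm_section_genB e _).2, if_neg hx]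
  ε_zero := by
    rw [exponent, dif_neg]
    exact fun h => add_one_ne_zero_iff.2 h (sub_add_cancel _ _)
  mem_zmultiples x := by
    induction x using Fin.induction with
    | zero => exact AddSubgroup.zero_mem _
    | succ i ih =>
      rw [← Fin.coeSucc_eq_succ]
      exact AddSubgroup.add_mem _ ih (AddSubgroup.mem_zmultiples _)
  faithful P hP g hg := by
    refine Subtype.ext (RelIso.ext fun u => ?_)
    change (g : TreeAut (k + 1)) u = u
    induction u generalizing g with
    | nil => exact apply_nil e g
    | cons x z ih =>
      obtain ⟨h1, h2⟩ := hP g hg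
      rw [apply_cons, ih _ (h2 x)]
      congr 1
      exact Equiv.congr_fun h1 x

theorem ggsRecursion_apply_cons (g : ggsGroup e) (x : Fin (k + 1)) (z : List (Fin (k + 1))) :
    (g : TreeAut (k + 1)) (x :: z)
      = (ggsRecursion e).perm g x :: ((ggsRecursion e).sec g x : TreeAut (k + 1)) z :=
  apply_cons e g x z

theorem exists_exponent_ne_zero {p : ℕ} (he : ∃ i, ¬ (p : ZMod (k + 1)) ∣ e i) :
    ∃ s, ((ggsRecursion e).ε s : ZMod p) ≠ 0 := by
  obtain ⟨i, hi⟩ := he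
  have hik : (i : ℕ) < k := i.2
  refine ⟨Fin.castSucc ⟨i, hik⟩ + 1, fun h => hi ?_⟩
  change (exponent e _ : ZMod p) = 0 at h
  have h1 : exponent e (Fin.castSucc ⟨i, hik⟩ + 1) = (e i).val := by
    rw [exponent, dif_pos (by rw [add_sub_cancel_right]; exact hik)]
    congr 2
    apply Fin.ext
    change ((Fin.castSucc ⟨i, hik⟩ + 1 - 1 : Fin (k + 1)) : ℕ) = i
    rw [add_sub_cancel_right]
    rfl
  rw [h1, ZMod.natCast_eq_zero_iff] at h
  obtain ⟨c, hc⟩ := h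
  refine ⟨(c : ZMod (k + 1)), ?_⟩
  rw [← ZMod.natCast_zmod_val (e i), hc, Nat.cast_mul]

theorem selfSimilar_ggsGroup : SelfSimilar (ggsGroup e) := by
  intro g hg u
  induction u generalizing g with
  | nil => exact ⟨g, hg, fun z => by rw [apply_nil e ⟨g, hg⟩]; rfl⟩
  | cons x u ih =>
    obtain ⟨h, hh, hs⟩ := ih (firstLevelSection e ⟨g, hg⟩ x) (firstLevelSection e ⟨g, hg⟩ x).2
    refine ⟨h, hh, fun z => ?_⟩
    rw [List.cons_append, apply_cons e ⟨g, hg⟩, apply_cons e ⟨g, hg⟩, hs z, List.cons_append]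

/-- By surjectivity of sections, an element fixing the first level moves the tail of the word below
`x`; a rotation, with trivial sections, then carries `x` to `y`. -/
theorem sphericallyTransitive_ggsGroup {p : ℕ} [Fact p.Prime] (hG : IsPGroup p (ggsGroup e))
    (he : ∃ s, ((ggsRecursion e).ε s : ZMod p) ≠ 0) : SphericallyTransitive (ggsGroup e) := by
  intro ℓ
  induction ℓ with
  | zero =>
    intro u v hu hv
    obtain rfl := List.length_eq_zero_iff.1 hu
    obtain rfl := List.length_eq_zero_iff.1 hv
    exact ⟨1, Subgroup.one_mem _, rfl⟩
  | succ ℓ ih =>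
    intro u v hu hv
    obtain ⟨x, u, rfl⟩ := List.exists_cons_of_length_eq_add_one hu
    obtain ⟨y, v, rfl⟩ := List.exists_cons_of_length_eq_add_one hv
    obtain ⟨g, hg, hguv⟩ := ih u v (Nat.succ.inj hu) (Nat.succ.inj hv)
    obtain ⟨s, hs⟩ := he
    obtain ⟨⟨h, hh⟩, hhg⟩ := (ggsRecursion e).secHom_surjective hG hs x ⟨g, hg⟩
    obtain ⟨t, ht, hts⟩ := (ggsRecursion e).exists_rotation (y - x)
    change (ggsRecursion e).sec h x = _ at hhg
    have hh1 : (ggsRecursion e).perm h = 1 := hh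
    refine ⟨t * h, (t * h).2, ?_⟩
    rw [RelIso.mul_apply, ggsRecursion_apply_cons, ggsRecursion_apply_cons, hhg, hh1, ht, hts]
    change (x + (y - x)) :: g u = y :: v
    rw [hguv, add_sub_cancel]

/-- The series is indexed from 0, so index 2 is `γ₃`. -/
theorem lowerCentralSeries_two_eq_map {G : Type*} [Group G] (H : Subgroup G) :
    H.lowerCentralSeries 2 = (gammaThree H).map H.subtype := by
  rw [Subgroup.map_commutator, commutator_def, Subgroup.map_commutator, ← MonoidHom.range_eq_map,
    Subgroup.range_subtype]
  rfl

theorem regularBranchOver_ggsGroup {p n : ℕ} (hp : p.Prime) (hn : 1 ≤ n) (hk : k + 1 = p ^ n)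
    (he : ∃ i, ¬ (p : ZMod (k + 1)) ∣ e i) (hper : ∀ g ∈ ggsGroup e, IsOfFinOrder g) :
    RegularBranchOver (ggsGroup e) ((ggsGroup e).lowerCentralSeries 2) := by
  have : Fact p.Prime := ⟨hp⟩
  let S := ggsRecursion e
  have hI : ∃ n, Fintype.card (Fin (k + 1)) = p ^ n := ⟨n, by rw [Fintype.card_fin, hk]⟩
  have hfin : ∀ g : ggsGroup e, IsOfFinOrder g := fun g =>
    Submonoid.isOfFinOrder_coe.1 (hper g g.2)
  have hG : IsPGroup p (ggsGroup e) := S.isPGroup_of_torsion hI hfin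
  have hε := exists_exponent_ne_zero e he
  have hw : S.w ≠ 0 := by
    change (1 : Fin (k + 1)) ≠ 0
    have h1 : 1 < p ^ n := Nat.one_lt_pow (by omega) hp.one_lt
    have h2 : (0 : Fin (k + 1)) + 1 ≠ 0 := add_one_ne_zero_iff.2 (by
      change 0 < k
      omega)
    rwa [zero_add] at h2
  have hsum := S.sum_eq_zero_of_torsion hI hw hfin
  have htop := S.branchSubgroup_eq_top hG hI hsum hε
  have hpsi : ∀ g ∈ gammaThree (ggsGroup e),
      PsiEq (g : TreeAut (k + 1)) fun x => (S.sec g x : TreeAut (k + 1)) := by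
    intro g hg
    have h1 : S.perm g = 1 := S.commutator_le_ker (Subgroup.commutator_le_left _ _ hg)
    have h2 : ∀ x z, (g : TreeAut (k + 1)) (x :: z) = x :: (S.sec g x : TreeAut (k + 1)) z := by
      intro x z
      rw [ggsRecursion_apply_cons]
      change S.perm g x :: _ = _
      rw [h1]
      rfl
    have h3 : ∀ x, (g : TreeAut (k + 1)) [x] = [x] := fun x => by rw [h2, apply_nil]
    refine ⟨fun u hu => ?_, fun x z => ?_⟩
    · obtain ⟨x, rfl⟩ := List.length_eq_one_iff.1 hu
      exact h3 x
    · rw [h3]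
      exact h2 x z
  rw [lowerCentralSeries_two_eq_map]
  refine ⟨⟨sphericallyTransitive_ggsGroup e hG hε, selfSimilar_ggsGroup e, ?_, ?_, ?_⟩, ⟨?_⟩⟩
  · rw [Ne, Subgroup.map_eq_bot_iff_of_injective _ (Subgroup.subtype_injective _)]
    exact S.gammaThree_ne_bot hI hsum hε
  · rintro _ ⟨g, hg, rfl⟩
    exact ⟨(hpsi g hg).1, g.2⟩
  · intro f hf
    choose l hl hlf using hf
    have h1 : (fun x => (⟨l x, hl x⟩ : gammaThree (ggsGroup e))) ∈ S.branchSubgroup := by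
      rw [htop]
      exact Subgroup.mem_top _
    obtain ⟨g, hg, hgl⟩ := h1
    refine ⟨g, ⟨g, hg, rfl⟩, ?_⟩
    have h2 : f = fun x => (S.sec g x : TreeAut (k + 1)) := funext fun x => by
      rw [hgl x, ← hlf x]
      rfl
    rw [h2]
    exact hpsi g hg
  · have := S.group_fg
    rw [Subgroup.relIndex, Subgroup.subgroupOf,
      Subgroup.comap_map_eq_self_of_injective (Subgroup.subtype_injective _)]
    exact (finiteIndex_gammaThree hfin).index_ne_zero

end Sections

/-- With `m` a variable, it can be replaced by `k + 1`, for which `Fin (k + 1)` is an additive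
group. -/
theorem regularBranchOver_ggsGroup_of_eq {p n m : ℕ} (hp : p.Prime) (hn : 1 ≤ n) (hm : m = p ^ n)
    (e : Fin (m - 1) → ZMod m) (he : ∃ i, ¬ (p : ZMod m) ∣ e i)
    (hper : ∀ g ∈ ggsGroup e, IsOfFinOrder g) :
    RegularBranchOver (ggsGroup e) ((ggsGroup e).lowerCentralSeries 2) := by
  cases m with
  | zero => exact absurd hm.symm (pow_ne_zero n hp.ne_zero)
  | succ k => exact regularBranchOver_ggsGroup e hp hn hm he hper

end GGS

theorem corollary2p9 (p n : ℕ) (hp : p.Prime) (hn : 1 ≤ n)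
    (e : Fin (p ^ n - 1) → ZMod (p ^ n)) (he : e ∈ GGS.nontrivialModP p n)
    (hper : ∀ g ∈ GGS.ggsGroup e, IsOfFinOrder g) :
    GGS.RegularBranchOver (GGS.ggsGroup e) ((GGS.ggsGroup e).lowerCentralSeries 2) :=
  GGS.regularBranchOver_ggsGroup_of_eq hp hn rfl e he hper
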